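/- Let $\mathfrak g$ be a finite-dimensional complex simple Lie algebra with Cartan subalgebra $\mathfrak h$, simple roots $\alpha_1,\dots,\alpha_r$, invariant form on $\mathfrak h^*$ normalized so that $(\alpha_i,\alpha_i)=2$ for short simple roots, $d_i=(\alpha_i,\alpha_i)/2$ and Cartan matrix $(a_{ij})$ given by $(\alpha_i,\alpha_j)=d_ia_{ij}$. Let $q>0$ be real, $q\neq1$, and $q_i=q^{d_i}$. Let $U_q(\mathfrak g)$ be the Hopf $*$-algebra generated by $E_i,F_i,K_i^{\pm1}$ with relations $K_iK_i^{-1}=K_i^{-1}K_i=1$, $K_iK_j=K_jK_i$, $K_iE_jK_i^{-1}=q_i^{a_{ij}}E_j$, $K_iF_jK_i^{-1}=q_i^{-a_{ij}}F_j$, $E_iF_j-F_jE_i=\delta_{ij}\frac{K_i-K_i^{-1}}{q_i-q_i^{-1}}$ and the quantum Serre relations, with $\Delta(K_i)=K_i\otimes K_i$, $\Delta(E_i)=E_i\otimes K_i+1\otimes E_i$, $\Delta(F_i)=F_i\otimes1+K_i^{-1}\otimes F_i$, $S(K_i)=K_i^{-1}$, $S(E_i)=-E_iK_i^{-1}$,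 $S(F_i)=-K_iF_i$, $\varepsilon(K_i)=1$, $\varepsilon(E_i)=\varepsilon(F_i)=0$, and $K_i^*=K_i$, $E_i^*=K_iF_i$, $F_i^*=E_iK_i^{-1}$. Let $\mathbb C_q[G]\subset U_q(\mathfrak g)^*$ be the span of the matrix coefficients of finite-dimensional (type 1) representations of $U_q(\mathfrak g)$, with product $(\phi\psi)(X)=(\phi\otimes\psi)(\Delta(X))$, involution $\phi^*(X)=\overline{\phi(S(X)^*)}$ and actions $(X\triangleright\phi)(Y)=\phi(YX)$, $(\phi\triangleleft X)(Y)=\phi(XY)$. For a subset $S$ of the simple roots let $U_q(\mathfrak l_S)\subset U_q(\mathfrak g)$ be the subalgebra generated by all $K_i^{\pm1}$ and by $E_i,F_i$ with $\alpha_i\in S$, and put $$\mathbb C_q[G/L_S]=\{a\in\mathbb C_q[G]: X\triangleright a=\varepsilon(X)a\ \ \forall X\in U_q(\mathfrak l_S)\},\qquad \mathbb C_q[L_S\backslash G]=\{a\in\mathbb C_q[G]: a\triangleleft X=\varepsilon(X)a\ \ \forall X\in U_q(\mathfrak l_S)\}.$$ Let $V(\Lambda)$ be the irreducible finite-dimensional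 representation with dominant integral highest weight $\Lambda$, with an inner product for which it is a $*$-representation, let $\{v_i\}$ be an orthonormal basis of it, $\{f^i\}$ the dual basis of $V(\Lambda)^*$, and $u^i_j(X)=f^i(X\triangleright v_j)$. Define matrices $\mathsf M^n_m,\mathsf N^n_m$ over $\mathbb C_q[G]$ by $(\mathsf M^n_m)^i_j=u^{m*}_iu^n_j$ and $(\mathsf N^n_m)^i_j=u^i_mu^{j*}_n$. For complex numbers $c^m_n$ put $$\mathsf P=\sum_{m,n}c^m_n\mathsf M^n_m,\qquad \mathsf Q=\sum_{m,n}c^m_n\mathsf N^n_m,\qquad w=\sum_{m,n}c^m_n\,v_m\otimes f^n\in V(\Lambda)\otimes V(\Lambda)^*,$$ where $U_q(\mathfrak g)$ acts on $V(\Lambda)^*$ by $(X\triangleright f)(v)=f(S(X)\triangleright v)$ and on the tensor product through $\Delta$. Then all $\mathsf P^i_j$ lie in $\mathbb C_q[L_S\backslash G]$ and all $\mathsf Q^i_j$ lie in $\mathbb C_q[G/L_S]$ if and only if $w$ is $U_q(\mathfrak l_S)$-invariant, i.e. $X\triangleright w=\varepsilon(X)w$ for all $X\in U_q(\mathfrak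 l_S)$. Moreover each of the two conditions, the one on $\mathsf P$ and the one on $\mathsf Q$, is by itself equivalent to the invariance of $w$. -/

import Mathlib

open scoped TensorProduct

noncomputable section

namespace QuantumFlag

/-! ### Quantum integers and binomial coefficients -/

/-- The quantum integer `[n]_t = t^(n-1) + t^(n-3) + ⋯ + t^(-(n-1))`, that is
`(t^n - t^(-n)) / (t - t⁻¹)`. -/
def qInt (t : ℝ) (n : ℕ) : ℝ :=
  ∑ k ∈ Finset.range n, t ^ ((n : ℤ) - 1 - 2 * k)

/-- The quantum factorial `[n]_t! = [1]_t [2]_t ⋯ [n]_t`. -/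
def qFactorial (t : ℝ) (n : ℕ) : ℝ :=
  ∏ k ∈ Finset.range n, qInt t (k + 1)

/-- The quantum binomial coefficient `[n]_t! / ([r]_t! [n-r]_t!)`, for `r ≤ n`. -/
def qBinom (t : ℝ) (n r : ℕ) : ℝ :=
  qFactorial t n / (qFactorial t r * qFactorial t (n - r))

theorem qInt_add {t : ℝ} (ht : 0 < t) (a b : ℕ) :
    qInt t (a + b) = t ^ (b : ℤ) * qInt t a + t ^ (-(a : ℤ)) * qInt t b := by
  unfold qInt
  rw [Finset.sum_range_add, Finset.mul_sum, Finset.mul_sum]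
  congr 1
  · refine Finset.sum_congr rfl fun k _ => ?_
    rw [← zpow_add₀ ht.ne']; congr 1; push_cast; ring
  · refine Finset.sum_congr rfl fun k _ => ?_
    rw [← zpow_add₀ ht.ne']; congr 1; push_cast; ring

theorem qInt_pos {t : ℝ} (ht : 0 < t) (n : ℕ) : 0 < qInt t (n + 1) := by
  unfold qInt
  exact Finset.sum_pos (fun k _ => zpow_pos ht _) (by simp)

theorem qFactorial_pos {t : ℝ} (ht : 0 < t) (n : ℕ) : 0 < qFactorial t n :=
  Finset.prod_pos fun k _ => qInt_pos ht k

theorem qFactorial_succ (t : ℝ) (n : ℕ) :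
    qFactorial t (n + 1) = qFactorial t n * qInt t (n + 1) := by
  simp [qFactorial, Finset.prod_range_succ]

theorem qBinom_zero_right {t : ℝ} (ht : 0 < t) (n : ℕ) : qBinom t n 0 = 1 := by
  have := (qFactorial_pos ht n).ne'
  simp only [qBinom, Nat.sub_zero]
  rw [show qFactorial t 0 = 1 by simp [qFactorial], one_mul, div_self this]

theorem qBinom_self {t : ℝ} (ht : 0 < t) (n : ℕ) : qBinom t n n = 1 := by
  have := (qFactorial_pos ht n).ne'
  simp only [qBinom, Nat.sub_self]
  rw [show qFactorial t 0 = 1 by simp [qFactorial], mul_one, div_self this]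

theorem qBinom_symm (t : ℝ) {n r : ℕ} (h : r ≤ n) : qBinom t n (n - r) = qBinom t n r := by
  simp only [qBinom, Nat.sub_sub_self h]
  rw [mul_comm (qFactorial t (n - r))]

/-- The quantum Pascal rule. -/
theorem qBinom_succ {t : ℝ} (ht : 0 < t) {n r : ℕ} (h : r < n) :
    qBinom t (n + 1) (r + 1) =
      t ^ (-((r : ℤ) + 1)) * qBinom t n (r + 1) + t ^ ((n : ℤ) - r) * qBinom t n r := by
  obtain ⟨m, rfl⟩ : ∃ m, n = r + m + 1 := ⟨n - r - 1, by omega⟩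
  have e1 : r + m + 1 + 1 - (r + 1) = m + 1 := by omega
  have e2 : r + m + 1 - (r + 1) = m := by omega
  have e3 : r + m + 1 - r = m + 1 := by omega
  simp only [qBinom, e1, e2, e3]
  have h1 := (qFactorial_pos ht (r + m + 1)).ne'
  have h2 := (qFactorial_pos ht r).ne'
  have h3 := (qFactorial_pos ht m).ne'
  have h4 := (qInt_pos ht r).ne'
  have h5 := (qInt_pos ht m).ne'
  have key := qInt_add ht (r + 1) (m + 1)
  rw [qFactorial_succ t (r + m + 1), qFactorial_succ t r, qFactorial_succ t m,
    show r + m + 1 + 1 = r + 1 + (m + 1) by ring, key,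
    show ((r + m + 1 : ℕ) : ℤ) - r = ((m + 1 : ℕ) : ℤ) by push_cast; ring,
    show (-((r : ℤ) + 1)) = -((r + 1 : ℕ) : ℤ) by push_cast; ring]
  field_simp
  ring

theorem qInt_inv (t : ℝ) (n : ℕ) : qInt t⁻¹ n = qInt t n := by
  unfold qInt
  rw [← Finset.sum_range_reflect]
  refine Finset.sum_congr rfl fun k hk => ?_
  have hk := Finset.mem_range.1 hk
  rw [inv_zpow', Nat.sub_sub, Nat.cast_sub (by omega)]
  congr 1; push_cast; ring

theorem qBinom_inv (t : ℝ) (n r : ℕ) : qBinom t⁻¹ n r = qBinom t n r := by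
  simp only [qBinom, qFactorial, qInt_inv]

/-! ### The quantum Serre expression -/

section Serre

variable {A : Type*} [Ring A] [Algebra ℂ A]

/-- The quantum Serre expression `∑_{r=0}^{n} (-1)^r [n; r]_t x^(n-r) y x^r`. -/
def serre (t : ℝ) (n : ℕ) (x y : A) : A :=
  ∑ r ∈ Finset.range (n + 1),
    (((-1) ^ r * qBinom t n r : ℝ) : ℂ) • (x ^ (n - r) * y * x ^ r)

/-- The iterated twisted commutators `z₀ = y`, `z_{s+1} = x z_s - e(s) z_s x`. -/
def iterComm (e : ℕ → ℂ) (x y : A) : ℕ → A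
  | 0 => y
  | s + 1 => x * iterComm e x y s - e s • (iterComm e x y s * x)

theorem iterComm_congr {e e' : ℕ → ℂ} (x y : A) (n : ℕ) (h : ∀ s < n, e s = e' s) :
    iterComm e x y n = iterComm e' x y n := by
  induction n with
  | zero => rfl
  | succ n ih =>
    simp only [iterComm]
    rw [ih fun s hs => h s (by omega), h n (by omega)]

theorem serre_scaled_eq_iterComm {t : ℝ} (ht : 0 < t) (x y : A) (n : ℕ) (c : ℝ) :
    ∑ r ∈ Finset.range (n + 1),
      (((-1) ^ r * qBinom t n r * c ^ r : ℝ) : ℂ) • (x ^ (n - r) * y * x ^ r) =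
    iterComm (fun s => ((c * t ^ (2 * (s : ℤ) - n + 1) : ℝ) : ℂ)) x y n := by
  induction n generalizing c with
  | zero => simp [iterComm, qBinom_self ht]
  | succ n ih =>
    have h0 := ih (c / t)
    have e1 : iterComm (fun s => ((c * t ^ (2 * (s : ℤ) - (n + 1 : ℕ) + 1) : ℝ) : ℂ)) x y n =
        iterComm (fun s => ((c / t * t ^ (2 * (s : ℤ) - n + 1) : ℝ) : ℂ)) x y n := by
      refine iterComm_congr x y n fun s _ => ?_
      congr 1
      rw [div_mul_eq_mul_div, mul_div_assoc, div_eq_mul_inv (t ^ _) t, ← zpow_sub_one₀ ht.ne']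
      congr 2; push_cast; ring
    simp only [iterComm]
    rw [e1, ← h0, Finset.mul_sum, Finset.sum_mul, Finset.smul_sum]
    rw [Finset.sum_range_succ', Finset.sum_range_succ]
    rw [Finset.sum_range_succ' (fun r => x * _), Finset.sum_range_succ (fun r => _ • (_ * x))]
    have e2 : ∀ r ∈ Finset.range n,
        (((-1) ^ (r + 1) * qBinom t (n + 1) (r + 1) * c ^ (r + 1) : ℝ) : ℂ) •
          (x ^ (n + 1 - (r + 1)) * y * x ^ (r + 1)) =
        x * ((((-1) ^ (r + 1) * qBinom t n (r + 1) * (c / t) ^ (r + 1) : ℝ) : ℂ) •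
          (x ^ (n - (r + 1)) * y * x ^ (r + 1))) -
        ((c * t ^ (2 * (n : ℤ) - (n + 1 : ℕ) + 1) : ℝ) : ℂ) •
          ((((-1) ^ r * qBinom t n r * (c / t) ^ r : ℝ) : ℂ) •
          (x ^ (n - r) * y * x ^ r) * x) := by
      intro r hr
      have hr := Finset.mem_range.1 hr
      have m1 : x * (x ^ (n - (r + 1)) * y * x ^ (r + 1)) = x ^ (n - r) * y * x ^ (r + 1) := by
        rw [← mul_assoc, ← mul_assoc, ← pow_succ', show n - (r + 1) + 1 = n - r by omega]
      have m2 : (x ^ (n - r) * y * x ^ r) * x = x ^ (n - r) * y * x ^ (r + 1) := by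
        rw [mul_assoc, ← pow_succ]
      rw [mul_smul_comm, smul_mul_assoc, m1, m2, smul_smul, ← sub_smul,
        show n + 1 - (r + 1) = n - r by omega]
      congr 1
      rw [← Complex.ofReal_mul, ← Complex.ofReal_sub]
      congr 1
      rw [qBinom_succ ht hr]
      have p1 : t ^ (-((r : ℤ) + 1)) = (t ^ (r + 1))⁻¹ := by
        rw [zpow_neg]; norm_cast
      have p2 : t ^ ((n : ℤ) - r) = t ^ n / t ^ r := by
        rw [zpow_sub₀ ht.ne']; norm_cast
      have p3 : t ^ (2 * (n : ℤ) - (n + 1 : ℕ) + 1) = t ^ n := by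
        rw [← zpow_natCast]; congr 1; push_cast; ring
      rw [p1, p2, p3, div_pow, div_pow]
      have := ht.ne'
      field_simp
      ring
    rw [Finset.sum_congr rfl e2, Finset.sum_sub_distrib]
    have e3 : x * ((((-1) ^ 0 * qBinom t n 0 * (c / t) ^ 0 : ℝ) : ℂ) •
        (x ^ (n - 0) * y * x ^ 0)) = (((-1) ^ 0 * qBinom t (n + 1) 0 * c ^ 0 : ℝ) : ℂ) •
        (x ^ (n + 1 - 0) * y * x ^ 0) := by
      simp [qBinom_zero_right ht, pow_succ', mul_assoc]
    have e4 : (((-1) ^ (n + 1) * qBinom t (n + 1) (n + 1) * c ^ (n + 1) : ℝ) : ℂ) •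
        (x ^ (n + 1 - (n + 1)) * y * x ^ (n + 1)) =
        -(((c * t ^ (2 * (n : ℤ) - (n + 1 : ℕ) + 1) : ℝ) : ℂ) •
          ((((-1) ^ n * qBinom t n n * (c / t) ^ n : ℝ) : ℂ) •
          (x ^ (n - n) * y * x ^ n) * x)) := by
      have p3 : t ^ (2 * (n : ℤ) - (n + 1 : ℕ) + 1) = t ^ n := by
        rw [← zpow_natCast]; congr 1; push_cast; ring
      rw [smul_mul_assoc, smul_smul, ← neg_smul, Nat.sub_self, Nat.sub_self, pow_zero, one_mul,
        mul_assoc y, ← pow_succ, ← Complex.ofReal_mul, ← Complex.ofReal_neg]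
      congr 2
      rw [qBinom_self ht, qBinom_self ht, p3, div_pow]
      have := ht.ne'
      field_simp
      ring
    rw [e3, e4]
    abel

theorem serre_eq_iterComm {t : ℝ} (ht : 0 < t) (x y : A) (n : ℕ) :
    serre t n x y = iterComm (fun s => ((t ^ (2 * (s : ℤ) - n + 1) : ℝ) : ℂ)) x y n := by
  have := serre_scaled_eq_iterComm ht x y n 1
  simpa [serre] using this

theorem serre_eq_iterComm' {t : ℝ} (ht : 0 < t) (x y : A) (n : ℕ) :
    serre t n x y = iterComm (fun s => ((t ^ (-(2 * (s : ℤ) - n + 1)) : ℝ) : ℂ)) x y n := by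
  have h := serre_eq_iterComm (inv_pos.2 ht) x y n
  rw [show serre t⁻¹ n x y = serre t n x y by simp only [serre, qBinom_inv]] at h
  rw [h]
  refine iterComm_congr x y n fun s _ => ?_
  rw [inv_zpow']

theorem serre_add_right (t : ℝ) (n : ℕ) (x y y' : A) :
    serre t n x (y + y') = serre t n x y + serre t n x y' := by
  simp only [serre, mul_add, add_mul, smul_add, Finset.sum_add_distrib]

theorem serre_zero (t : ℝ) (n : ℕ) (x : A) : serre t n x 0 = 0 := by
  simp [serre]

theorem map_serre {B : Type*} [Ring B] [Algebra ℂ B] (f : A →ₐ[ℂ] B) (t : ℝ) (n : ℕ) (x y : A) :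
    f (serre t n x y) = serre t n (f x) (f y) := by
  simp [serre]

/-- Adding to `x` an element that commutes up to the right scalars. -/
theorem iterComm_add (e : ℕ → ℂ) (x a y : A) (u w : ℂ) (hx : a * x = u • (x * a))
    (hy : a * y = w • (y * a)) (he : ∀ s, e s = w * u ^ s) (n : ℕ) :
    iterComm e (x + a) y n = iterComm e x y n ∧
      a * iterComm e x y n = (w * u ^ n) • (iterComm e x y n * a) := by
  induction n with
  | zero => simpa [iterComm] using hy
  | succ n ih =>
    obtain ⟨h1, h2⟩ := ih
    set z := iterComm e x y n with hz
    refine ⟨?_, ?_⟩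
    · simp only [iterComm]
      rw [h1, add_mul, mul_add, h2, he, smul_add]
      abel
    · simp only [iterComm]
      rw [← hz, mul_sub, ← mul_assoc, hx, mul_smul_comm, ← mul_assoc a, h2, smul_mul_assoc,
        smul_mul_assoc, mul_assoc x, h2, mul_assoc z, hx, sub_mul, mul_smul_comm, mul_smul_comm,
        smul_sub, smul_mul_assoc]
      simp only [smul_smul, mul_assoc]
      congr 2
      · ring
      · ring

/-- Multiplying `x` and `y` by commuting elements that commute with them up to scalars. -/
theorem iterComm_twist (e : ℕ → ℂ) (x y k l : A) (u w : ℂ) (hkl : k * l = l * k)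
    (hxk : x * k = u • (k * x)) (hxl : x * l = w • (l * x)) (hyk : y * k = w • (k * y)) (n : ℕ) :
    (∃ κ : ℂ, iterComm e (k * x) (l * y) n = κ • (k ^ n * l * iterComm e x y n)) ∧
      iterComm e x y n * k = (w * u ^ n) • (k * iterComm e x y n) ∧
      x * (k ^ n * l) = (w * u ^ n) • (k ^ n * l * x) := by
  induction n with
  | zero =>
    refine ⟨⟨1, by simp [iterComm]⟩, by simpa [iterComm] using hyk, by simpa using hxl⟩
  | succ n ih =>
    obtain ⟨⟨κ, h1⟩, h2, h3⟩ := ih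
    set z := iterComm e x y n with hz
    refine ⟨⟨κ * (w * u ^ n), ?_⟩, ?_, ?_⟩
    · simp only [iterComm]
      rw [h1, ← hz]
      have a1 : k * x * (k ^ n * l * z) = (w * u ^ n) • (k ^ (n + 1) * l * (x * z)) := by
        rw [mul_assoc k, ← mul_assoc x, h3, smul_mul_assoc, mul_smul_comm, pow_succ']
        simp only [mul_assoc]
      have a2 : k ^ n * l * z * (k * x) = (w * u ^ n) • (k ^ (n + 1) * l * (z * x)) := by
        rw [mul_assoc (k ^ n * l), ← mul_assoc z, h2, smul_mul_assoc, mul_smul_comm, pow_succ]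
        congr 1
        rw [mul_assoc (k ^ n) k l, hkl]
        simp only [mul_assoc]
      rw [mul_smul_comm, smul_mul_assoc, a1, a2, mul_sub, smul_sub, mul_smul_comm]
      simp only [smul_smul]
      congr 2
      ring
    · simp only [iterComm]
      rw [← hz, sub_mul, mul_assoc, h2, smul_mul_assoc, mul_assoc z, hxk, mul_smul_comm,
        mul_smul_comm, ← mul_assoc x, hxk, ← mul_assoc z, h2, mul_sub, smul_sub, mul_smul_comm]
      simp only [smul_mul_assoc, smul_smul, mul_assoc]
      congr 2
      all_goals ring
    · rw [pow_succ', mul_assoc k, ← mul_assoc x, hxk, smul_mul_assoc, mul_assoc k, h3,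
        mul_smul_comm, smul_smul, ← mul_assoc k]
      congr 1
      ring

theorem serre_twist {t : ℝ} (ht : 0 < t) (n : ℕ) (x y k l : A) (u w : ℂ) (hkl : k * l = l * k)
    (hxk : x * k = u • (k * x)) (hxl : x * l = w • (l * x)) (hyk : y * k = w • (k * y))
    (h : serre t n x y = 0) : serre t n (k * x) (l * y) = 0 := by
  rw [serre_eq_iterComm ht] at h ⊢
  obtain ⟨⟨κ, h1⟩, -⟩ := iterComm_twist
    (fun s => ((t ^ (2 * (s : ℤ) - n + 1) : ℝ) : ℂ)) x y k l u w hkl hxk hxl hyk n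
  rw [h1, h, mul_zero, smul_zero]

/-- Antimultiplicative maps that are linear over the real scalars preserve the Serre expression
up to sign. -/
theorem serre_anti {B : Type*} [Ring B] [Algebra ℂ B] (φ : A →+ B)
    (hmul : ∀ x y, φ (x * y) = φ y * φ x) (hone : φ 1 = 1)
    (hreal : ∀ (r : ℝ) x, φ ((r : ℂ) • x) = (r : ℂ) • φ x) (t : ℝ) (n : ℕ) (x y : A) :
    serre t n (φ x) (φ y) = ((-1 : ℂ) ^ n) • φ (serre t n x y) := by
  have hpow : ∀ (x : A) (m : ℕ), φ (x ^ m) = φ x ^ m := by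
    intro x m
    induction m with
    | zero => simpa using hone
    | succ m ih => rw [pow_succ, hmul, ih, pow_succ']
  simp only [serre]
  rw [← Finset.sum_range_reflect, map_sum, Finset.smul_sum]
  refine Finset.sum_congr rfl fun r hr => ?_
  have hr := Finset.mem_range.1 hr
  have e1 : n + 1 - 1 - r = n - r := by omega
  have e2 : n - (n - r) = r := by omega
  rw [e1, e2, qBinom_symm t (by omega), hreal, smul_smul, hmul, hmul, hpow, hpow, ← mul_assoc]
  congr 1
  push_cast
  rw [← mul_assoc]
  congr 1
  obtain ⟨m, rfl⟩ : ∃ m, n = r + m := ⟨n - r, by omega⟩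
  rw [Nat.add_sub_cancel_left, pow_add, mul_right_comm, ← mul_pow]
  simp

end Serre

/-! ### The quantized enveloping algebra -/

/-- The numerical data defining a quantized enveloping algebra: a symmetrizable Cartan matrix
`a`, its symmetrizing numbers `d i = (α_i, α_i) / 2`, and a real deformation parameter `q`. -/
structure Datum (I : Type*) where
  a : I → I → ℤ
  d : I → ℝ
  q : ℝ
  q_pos : 0 < q
  q_ne_one : q ≠ 1
  a_self : ∀ i, a i i = 2
  a_nonpos : ∀ i j, i ≠ j → a i j ≤ 0
  d_pos : ∀ i, 0 < d i
  symm : ∀ i j, d i * a i j = d j * a j i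

/-- Generators of the quantized enveloping algebra. -/
inductive Gen (I : Type*) where
  | E : I → Gen I
  | F : I → Gen I
  | K : I → Gen I
  | Kinv : I → Gen I

variable {I : Type*}

namespace Datum

variable (D : Datum I)

/-- `q_i = q^(d_i)`. -/
def qi (i : I) : ℝ := D.q ^ D.d i

/-- `q_i^(a_ij) = q^((α_i, α_j))` -/
def qa (i j : I) : ℂ := ((D.qi i ^ D.a i j : ℝ) : ℂ)

/-- The exponent `1 - a_ij` of the quantum Serre relations, for `i ≠ j`. -/
def serreExp (i j : I) : ℕ := (1 - D.a i j).toNat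

theorem qi_pos (i : I) : 0 < D.qi i := Real.rpow_pos_of_pos D.q_pos _

theorem qa_ne_zero (i j : I) : D.qa i j ≠ 0 := by
  unfold qa
  exact_mod_cast (zpow_pos (D.qi_pos i) _).ne'

theorem qa_symm (i j : I) : D.qa i j = D.qa j i := by
  unfold qa qi
  congr 1
  rw [← Real.rpow_intCast, ← Real.rpow_intCast, ← Real.rpow_mul D.q_pos.le,
    ← Real.rpow_mul D.q_pos.le, D.symm]

theorem qa_self (i : I) : D.qa i i = ((D.qi i : ℝ) : ℂ) ^ 2 := by
  unfold qa
  rw [D.a_self]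
  norm_cast

theorem conj_qa (i j : I) : starRingEnd ℂ (D.qa i j) = D.qa i j := by
  simp only [qa, Complex.conj_ofReal]

theorem serreExp_cast {i j : I} (h : i ≠ j) : (D.serreExp i j : ℤ) = 1 - D.a i j := by
  have := D.a_nonpos i j h
  unfold serreExp
  omega

/-- The defining relations of the quantized enveloping algebra. -/
inductive Rel : FreeAlgebra ℂ (Gen I) → FreeAlgebra ℂ (Gen I) → Prop
  | K_Kinv (i : I) : Rel (FreeAlgebra.ι ℂ (Gen.K i) * FreeAlgebra.ι ℂ (Gen.Kinv i)) 1
  | Kinv_K (i : I) : Rel (FreeAlgebra.ι ℂ (Gen.Kinv i) * FreeAlgebra.ι ℂ (Gen.K i)) 1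
  | K_K (i j : I) : Rel (FreeAlgebra.ι ℂ (Gen.K i) * FreeAlgebra.ι ℂ (Gen.K j))
      (FreeAlgebra.ι ℂ (Gen.K j) * FreeAlgebra.ι ℂ (Gen.K i))
  | K_E (i j : I) : Rel
      (FreeAlgebra.ι ℂ (Gen.K i) * FreeAlgebra.ι ℂ (Gen.E j) * FreeAlgebra.ι ℂ (Gen.Kinv i))
      (D.qa i j • FreeAlgebra.ι ℂ (Gen.E j))
  | K_F (i j : I) : Rel
      (FreeAlgebra.ι ℂ (Gen.K i) * FreeAlgebra.ι ℂ (Gen.F j) * FreeAlgebra.ι ℂ (Gen.Kinv i))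
      ((D.qa i j)⁻¹ • FreeAlgebra.ι ℂ (Gen.F j))
  | E_F_self (i : I) : Rel
      (FreeAlgebra.ι ℂ (Gen.E i) * FreeAlgebra.ι ℂ (Gen.F i) -
        FreeAlgebra.ι ℂ (Gen.F i) * FreeAlgebra.ι ℂ (Gen.E i))
      (((D.qi i - (D.qi i)⁻¹ : ℝ) : ℂ)⁻¹ •
        (FreeAlgebra.ι ℂ (Gen.K i) - FreeAlgebra.ι ℂ (Gen.Kinv i)))
  | E_F_ne (i j : I) (h : i ≠ j) : Rel
      (FreeAlgebra.ι ℂ (Gen.E i) * FreeAlgebra.ι ℂ (Gen.F j) -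
        FreeAlgebra.ι ℂ (Gen.F j) * FreeAlgebra.ι ℂ (Gen.E i)) 0
  | serre_E (i j : I) (h : i ≠ j) : Rel
      (serre (D.qi i) (D.serreExp i j) (FreeAlgebra.ι ℂ (Gen.E i)) (FreeAlgebra.ι ℂ (Gen.E j))) 0
  | serre_F (i j : I) (h : i ≠ j) : Rel
      (serre (D.qi i) (D.serreExp i j) (FreeAlgebra.ι ℂ (Gen.F i)) (FreeAlgebra.ι ℂ (Gen.F j))) 0

/-- Elements of an algebra that satisfy the relations of the quantized enveloping algebra
(in a form without conjugation by `K_i`). -/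
structure Satisfies {A : Type*} [Ring A] [Algebra ℂ A] (e f k k' : I → A) : Prop where
  K_Kinv : ∀ i, k i * k' i = 1
  Kinv_K : ∀ i, k' i * k i = 1
  K_K : ∀ i j, k i * k j = k j * k i
  K_E : ∀ i j, k i * e j = D.qa i j • (e j * k i)
  K_F : ∀ i j, D.qa i j • (k i * f j) = f j * k i
  E_F_self : ∀ i, e i * f i - f i * e i = ((D.qi i - (D.qi i)⁻¹ : ℝ) : ℂ)⁻¹ • (k i - k' i)
  E_F_ne : ∀ i j, i ≠ j → e i * f j - f j * e i = 0
  serre_E : ∀ i j, i ≠ j → serre (D.qi i) (D.serreExp i j) (e i) (e j) = 0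
  serre_F : ∀ i j, i ≠ j → serre (D.qi i) (D.serreExp i j) (f i) (f j) = 0

end Datum

/-- The quantized enveloping algebra `U_q(𝔤)`: the algebra with generators
`E_i, F_i, K_i, K_i⁻¹` and the defining relations `Datum.Rel`. -/
def Uq (D : Datum I) : Type _ := RingQuot D.Rel

namespace Uq

variable {D : Datum I}

instance : Ring (Uq D) := inferInstanceAs (Ring (RingQuot D.Rel))

instance : Algebra ℂ (Uq D) := inferInstanceAs (Algebra ℂ (RingQuot D.Rel))

/-- The projection from the free algebra. -/
def mk (D : Datum I) : FreeAlgebra ℂ (Gen I) →ₐ[ℂ] Uq D := RingQuot.mkAlgHom ℂ D.Rel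

theorem mk_surjective : Function.Surjective (mk D) := RingQuot.mkAlgHom_surjective ℂ D.Rel

theorem mk_rel {x y : FreeAlgebra ℂ (Gen I)} (h : D.Rel x y) : mk D x = mk D y :=
  RingQuot.mkAlgHom_rel ℂ h

/-- The generator `E_i`. -/
def E (D : Datum I) (i : I) : Uq D := mk D (FreeAlgebra.ι ℂ (Gen.E i))
/-- The generator `F_i`. -/
def F (D : Datum I) (i : I) : Uq D := mk D (FreeAlgebra.ι ℂ (Gen.F i))
/-- The generator `K_i`. -/
def K (D : Datum I) (i : I) : Uq D := mk D (FreeAlgebra.ι ℂ (Gen.K i))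
/-- The generator `K_i⁻¹`. -/
def Kinv (D : Datum I) (i : I) : Uq D := mk D (FreeAlgebra.ι ℂ (Gen.Kinv i))

theorem induction {P : Uq D → Prop} (scalar : ∀ r, P (algebraMap ℂ (Uq D) r))
    (hE : ∀ i, P (E D i)) (hF : ∀ i, P (F D i)) (hK : ∀ i, P (K D i)) (hKinv : ∀ i, P (Kinv D i))
    (mul : ∀ x y, P x → P y → P (x * y)) (add : ∀ x y, P x → P y → P (x + y)) (x : Uq D) :
    P x := by
  obtain ⟨x, rfl⟩ := mk_surjective x
  induction x using FreeAlgebra.induction with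
  | grade0 r => rw [AlgHom.commutes]; exact scalar r
  | grade1 g => cases g with
    | E i => exact hE i
    | F i => exact hF i
    | K i => exact hK i
    | Kinv i => exact hKinv i
  | mul x y hx hy => rw [map_mul]; exact mul _ _ hx hy
  | add x y hx hy => rw [map_add]; exact add _ _ hx hy

theorem algHom_ext {A : Type*} [Ring A] [Algebra ℂ A] {f g : Uq D →ₐ[ℂ] A}
    (hE : ∀ i, f (E D i) = g (E D i)) (hF : ∀ i, f (F D i) = g (F D i))
    (hK : ∀ i, f (K D i) = g (K D i)) (hKinv : ∀ i, f (Kinv D i) = g (Kinv D i)) : f = g := by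
  ext x
  induction x using Uq.induction with
  | scalar r => simp
  | hE i => exact hE i
  | hF i => exact hF i
  | hK i => exact hK i
  | hKinv i => exact hKinv i
  | mul x y hx hy => rw [map_mul, map_mul, hx, hy]
  | add x y hx hy => rw [map_add, map_add, hx, hy]

theorem K_Kinv (i : I) : K D i * Kinv D i = 1 := by
  simpa [K, Kinv] using mk_rel (Datum.Rel.K_Kinv (D := D) i)

theorem Kinv_K (i : I) : Kinv D i * K D i = 1 := by
  simpa [K, Kinv] using mk_rel (Datum.Rel.Kinv_K (D := D) i)

theorem mul_Kinv_cancel (x : Uq D) (i : I) : x * K D i * Kinv D i = x := by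
  rw [mul_assoc, K_Kinv, mul_one]

theorem mul_K_cancel (x : Uq D) (i : I) : x * Kinv D i * K D i = x := by
  rw [mul_assoc, Kinv_K, mul_one]

theorem K_E (i j : I) : K D i * E D j = D.qa i j • (E D j * K D i) := by
  have h := mk_rel (Datum.Rel.K_E (D := D) i j)
  simp only [map_mul, map_smul] at h
  change K D i * E D j * Kinv D i = D.qa i j • E D j at h
  rw [← smul_mul_assoc, ← h, mul_K_cancel]

theorem K_F (i j : I) : D.qa i j • (K D i * F D j) = F D j * K D i := by
  have h := mk_rel (Datum.Rel.K_F (D := D) i j)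
  simp only [map_mul, map_smul] at h
  change K D i * F D j * Kinv D i = (D.qa i j)⁻¹ • F D j at h
  have h2 := congrArg (fun x => D.qa i j • (x * K D i)) h
  simp only [mul_K_cancel, smul_mul_assoc, smul_smul, mul_inv_cancel₀ (D.qa_ne_zero i j),
    one_smul] at h2
  exact h2

theorem satisfies (D : Datum I) : D.Satisfies (E D) (F D) (K D) (Kinv D) where
  K_Kinv := K_Kinv
  Kinv_K := Kinv_K
  K_K i j := by simpa [K] using mk_rel (Datum.Rel.K_K (D := D) i j)
  K_E := K_E
  K_F := K_F
  E_F_self i := by simpa [E, F, K, Kinv] using mk_rel (Datum.Rel.E_F_self (D := D) i)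
  E_F_ne i j h := by simpa [E, F] using mk_rel (Datum.Rel.E_F_ne (D := D) i j h)
  serre_E i j h := by simpa [E, map_serre] using mk_rel (Datum.Rel.serre_E (D := D) i j h)
  serre_F i j h := by simpa [F, map_serre] using mk_rel (Datum.Rel.serre_F (D := D) i j h)

end Uq

namespace Datum.Satisfies

variable {D : Datum I} {A : Type*} [Ring A] [Algebra ℂ A] {e f k k' : I → A}

theorem Kinv_E (h : D.Satisfies e f k k') (i j : I) : e j * k' i = D.qa i j • (k' i * e j) := by
  have h1 := congrArg (fun x => k' i * x * k' i) (h.K_E i j)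
  simp only [← mul_assoc, h.Kinv_K, one_mul, mul_smul_comm, smul_mul_assoc] at h1
  simpa only [mul_assoc, h.K_Kinv, mul_one] using h1

theorem Kinv_F (h : D.Satisfies e f k k') (i j : I) : D.qa i j • (f j * k' i) = k' i * f j := by
  have h1 := congrArg (fun x => k' i * x * k' i) (h.K_F i j)
  simp only [← mul_assoc, h.Kinv_K, one_mul, mul_smul_comm, smul_mul_assoc] at h1
  simpa only [mul_assoc, h.K_Kinv, mul_one] using h1

theorem K_Kinv_comm (h : D.Satisfies e f k k') (i j : I) : k i * k' j = k' j * k i := by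
  have h1 := congrArg (fun x => k' j * x * k' j) (h.K_K i j)
  simp only [← mul_assoc, h.Kinv_K, one_mul] at h1
  simp only [mul_assoc, h.K_Kinv, mul_one] at h1
  exact h1.symm

theorem Kinv_Kinv (h : D.Satisfies e f k k') (i j : I) : k' i * k' j = k' j * k' i := by
  have h1 := congrArg (fun x => k' i * x * k' i) (h.K_Kinv_comm i j)
  simp only [← mul_assoc, h.Kinv_K, one_mul] at h1
  simp only [mul_assoc, h.K_Kinv, mul_one] at h1
  exact h1.symm

end Datum.Satisfies

namespace Uq

variable {D : Datum I}

/-- The universal property of the quantized enveloping algebra. -/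
def lift {A : Type*} [Ring A] [Algebra ℂ A] {e f k k' : I → A} (h : D.Satisfies e f k k') :
    Uq D →ₐ[ℂ] A :=
  RingQuot.liftAlgHom ℂ ⟨FreeAlgebra.lift ℂ fun g => match g with
    | Gen.E i => e i
    | Gen.F i => f i
    | Gen.K i => k i
    | Gen.Kinv i => k' i, by
    intro x y hxy
    induction hxy with
    | K_Kinv i => simpa using h.K_Kinv i
    | Kinv_K i => simpa using h.Kinv_K i
    | K_K i j => simpa using h.K_K i j
    | K_E i j =>
      simp only [map_mul, map_smul, FreeAlgebra.lift_ι_apply]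
      rw [h.K_E, smul_mul_assoc, mul_assoc, h.K_Kinv, mul_one]
    | K_F i j =>
      simp only [map_mul, map_smul, FreeAlgebra.lift_ι_apply]
      rw [eq_inv_smul_iff₀ (D.qa_ne_zero i j), ← smul_mul_assoc, h.K_F, mul_assoc, h.K_Kinv,
        mul_one]
    | E_F_self i => simpa using h.E_F_self i
    | E_F_ne i j hij => simpa using h.E_F_ne i j hij
    | serre_E i j hij => simpa [map_serre] using h.serre_E i j hij
    | serre_F i j hij => simpa [map_serre] using h.serre_F i j hij⟩

section

variable {A : Type*} [Ring A] [Algebra ℂ A] {e f k k' : I → A} (h : D.Satisfies e f k k')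

@[simp] theorem lift_E (i : I) : lift h (E D i) = e i :=
  (RingQuot.liftAlgHom_mkAlgHom_apply ℂ _ _ _).trans (FreeAlgebra.lift_ι_apply _ _)

@[simp] theorem lift_F (i : I) : lift h (F D i) = f i :=
  (RingQuot.liftAlgHom_mkAlgHom_apply ℂ _ _ _).trans (FreeAlgebra.lift_ι_apply _ _)

@[simp] theorem lift_K (i : I) : lift h (K D i) = k i :=
  (RingQuot.liftAlgHom_mkAlgHom_apply ℂ _ _ _).trans (FreeAlgebra.lift_ι_apply _ _)

@[simp] theorem lift_Kinv (i : I) : lift h (Kinv D i) = k' i :=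
  (RingQuot.liftAlgHom_mkAlgHom_apply ℂ _ _ _).trans (FreeAlgebra.lift_ι_apply _ _)

end

/-! ### The Hopf algebra structure -/

theorem satisfies_counit (D : Datum I) :
    D.Satisfies (A := ℂ) (fun _ => 0) (fun _ => 0) (fun _ => 1) (fun _ => 1) where
  K_Kinv _ := by simp
  Kinv_K _ := by simp
  K_K _ _ := by simp
  K_E _ _ := by simp
  K_F _ _ := by simp
  E_F_self _ := by simp
  E_F_ne _ _ _ := by simp
  serre_E _ _ _ := serre_zero _ _ _
  serre_F _ _ _ := serre_zero _ _ _

/-- The counit `ε(K_i) = 1`, `ε(E_i) = ε(F_i) = 0`. -/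
def counitHom (D : Datum I) : Uq D →ₐ[ℂ] ℂ := lift (satisfies_counit D)

theorem serre_tmul_left (t : ℝ) (n : ℕ) (x y k l : Uq D) (hkl : k * l = l * k)
    (h : serre t n x y = 0) : serre t n (x ⊗ₜ[ℂ] k) (y ⊗ₜ[ℂ] l) = 0 := by
  have e : serre t n (x ⊗ₜ[ℂ] k) (y ⊗ₜ[ℂ] l) = serre t n x y ⊗ₜ[ℂ] (k ^ n * l) := by
    simp only [serre]
    rw [TensorProduct.sum_tmul]
    refine Finset.sum_congr rfl fun r hr => ?_
    have hr := Finset.mem_range.1 hr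
    simp only [Algebra.TensorProduct.tmul_pow, Algebra.TensorProduct.tmul_mul_tmul,
      TensorProduct.smul_tmul']
    congr 1
    have hc : Commute l (k ^ r) := (show Commute k l from hkl).symm.pow_right r
    rw [mul_assoc, hc.eq, ← mul_assoc (k ^ (n - r)), ← pow_add,
      Nat.sub_add_cancel (by omega)]
  rw [e, h, TensorProduct.zero_tmul]

theorem serre_tmul_right (t : ℝ) (n : ℕ) (x y k l : Uq D) (hkl : k * l = l * k)
    (h : serre t n x y = 0) : serre t n (k ⊗ₜ[ℂ] x) (l ⊗ₜ[ℂ] y) = 0 := by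
  have e : serre t n (k ⊗ₜ[ℂ] x) (l ⊗ₜ[ℂ] y) = (k ^ n * l) ⊗ₜ[ℂ] serre t n x y := by
    simp only [serre]
    rw [TensorProduct.tmul_sum]
    refine Finset.sum_congr rfl fun r hr => ?_
    have hr := Finset.mem_range.1 hr
    simp only [Algebra.TensorProduct.tmul_pow, Algebra.TensorProduct.tmul_mul_tmul,
      TensorProduct.tmul_smul]
    congr 2
    have hc : Commute l (k ^ r) := (show Commute k l from hkl).symm.pow_right r
    rw [mul_assoc, hc.eq, ← mul_assoc (k ^ (n - r)), ← pow_add,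
      Nat.sub_add_cancel (by omega)]
  rw [e, h, TensorProduct.tmul_zero]

theorem scalar_eq {i j : I} (hij : i ≠ j) (s : ℕ) :
    ((D.qi i ^ (2 * (s : ℤ) - D.serreExp i j + 1) : ℝ) : ℂ) =
      D.qa i j * ((D.qi i : ℂ) ^ 2) ^ s := by
  have h0 := (D.qi_pos i).ne'
  rw [D.serreExp_cast hij, show 2 * (s : ℤ) - (1 - D.a i j) + 1 = D.a i j + (2 * s : ℕ) by
    push_cast; ring, zpow_add₀ h0, zpow_natCast, pow_mul]
  simp [Datum.qa]

theorem scalar_eq' {i j : I} (hij : i ≠ j) (s : ℕ) :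
    ((D.qi i ^ (-(2 * (s : ℤ) - D.serreExp i j + 1)) : ℝ) : ℂ) =
      (D.qa i j)⁻¹ * (((D.qi i : ℂ) ^ 2)⁻¹) ^ s := by
  rw [zpow_neg, Complex.ofReal_inv, scalar_eq hij, mul_inv, inv_pow]

/-- Splitting of the Serre expression of sums of two families that commute up to scalars. -/
theorem serre_add_add {A : Type*} [Ring A] [Algebra ℂ A] {i j : I} (hij : i ≠ j)
    (x a y b : A) (hxa : a * x = (D.qi i : ℂ) ^ 2 • (x * a)) (hay : a * y = D.qa i j • (y * a))
    (hbx : b * x = D.qa i j • (x * b)) (hx : serre (D.qi i) (D.serreExp i j) x y = 0)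
    (ha : serre (D.qi i) (D.serreExp i j) a b = 0) :
    serre (D.qi i) (D.serreExp i j) (x + a) (y + b) = 0 := by
  have h0 : (D.qi i : ℂ) ^ 2 ≠ 0 := by
    have := (D.qi_pos i).ne'
    exact pow_ne_zero _ (by exact_mod_cast this)
  rw [serre_add_right]
  have h1 : serre (D.qi i) (D.serreExp i j) (x + a) y = 0 := by
    rw [serre_eq_iterComm (D.qi_pos i)] at hx ⊢
    rw [(iterComm_add _ x a y _ _ hxa hay (scalar_eq hij) _).1, hx]
  have h2 : serre (D.qi i) (D.serreExp i j) (x + a) b = 0 := by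
    rw [serre_eq_iterComm' (D.qi_pos i)] at ha ⊢
    rw [add_comm x a, (iterComm_add _ a x b ((D.qi i : ℂ) ^ 2)⁻¹ (D.qa i j)⁻¹ ?_ ?_
      (scalar_eq' hij) _).1, ha]
    · rw [hxa, smul_smul, inv_mul_cancel₀ h0, one_smul]
    · rw [hbx, smul_smul, inv_mul_cancel₀ (D.qa_ne_zero i j), one_smul]
  rw [h1, h2, add_zero]

theorem satisfies_comul (D : Datum I) :
    D.Satisfies (A := Uq D ⊗[ℂ] Uq D) (fun i => E D i ⊗ₜ K D i + 1 ⊗ₜ E D i)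
      (fun i => F D i ⊗ₜ 1 + Kinv D i ⊗ₜ F D i) (fun i => K D i ⊗ₜ K D i)
      (fun i => Kinv D i ⊗ₜ Kinv D i) := by
  have hs := satisfies D
  have cross : ∀ i j, (E D i * Kinv D j) ⊗ₜ[ℂ] (K D i * F D j) =
      (Kinv D j * E D i) ⊗ₜ[ℂ] (F D j * K D i) := by
    intro i j
    rw [hs.Kinv_E, ← hs.K_F, TensorProduct.smul_tmul, D.qa_symm]
  refine ⟨?_, ?_, ?_, ?_, ?_, ?_, ?_, ?_, ?_⟩
  · intro i
    simp [hs.K_Kinv, Algebra.TensorProduct.one_def]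
  · intro i
    simp [hs.Kinv_K, Algebra.TensorProduct.one_def]
  · intro i j
    simp [hs.K_K i j]
  · intro i j
    simp only [mul_add, add_mul, smul_add, Algebra.TensorProduct.tmul_mul_tmul, mul_one, one_mul]
    rw [hs.K_E, hs.K_K i j, TensorProduct.smul_tmul', TensorProduct.tmul_smul]
  · intro i j
    simp only [mul_add, add_mul, smul_add, Algebra.TensorProduct.tmul_mul_tmul, mul_one, one_mul]
    rw [← hs.K_F, hs.K_Kinv_comm i j, TensorProduct.smul_tmul', TensorProduct.tmul_smul]
  · intro i
    simp only [mul_add, add_mul, Algebra.TensorProduct.tmul_mul_tmul, mul_one, one_mul]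
    rw [cross i i]
    have h1 : (E D i * F D i) ⊗ₜ[ℂ] K D i - (F D i * E D i) ⊗ₜ[ℂ] K D i =
        ((D.qi i - (D.qi i)⁻¹ : ℝ) : ℂ)⁻¹ • ((K D i - Kinv D i) ⊗ₜ[ℂ] K D i) := by
      rw [← TensorProduct.sub_tmul, hs.E_F_self, TensorProduct.smul_tmul']
    have h2 : Kinv D i ⊗ₜ[ℂ] (E D i * F D i) - Kinv D i ⊗ₜ[ℂ] (F D i * E D i) =
        ((D.qi i - (D.qi i)⁻¹ : ℝ) : ℂ)⁻¹ • (Kinv D i ⊗ₜ[ℂ] (K D i - Kinv D i)) := by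
      rw [← TensorProduct.tmul_sub, hs.E_F_self, TensorProduct.tmul_smul]
    have h3 : K D i ⊗ₜ[ℂ] K D i - Kinv D i ⊗ₜ[ℂ] Kinv D i =
        (K D i - Kinv D i) ⊗ₜ[ℂ] K D i + Kinv D i ⊗ₜ[ℂ] (K D i - Kinv D i) := by
      rw [TensorProduct.sub_tmul, TensorProduct.tmul_sub]
      abel
    rw [h3, smul_add, ← h1, ← h2]
    abel
  · intro i j hij
    simp only [mul_add, add_mul, Algebra.TensorProduct.tmul_mul_tmul, mul_one, one_mul]
    rw [cross i j]
    have h1 : (E D i * F D j) ⊗ₜ[ℂ] K D i - (F D j * E D i) ⊗ₜ[ℂ] K D i = 0 := by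
      rw [← TensorProduct.sub_tmul, hs.E_F_ne i j hij, TensorProduct.zero_tmul]
    have h2 : Kinv D j ⊗ₜ[ℂ] (E D i * F D j) - Kinv D j ⊗ₜ[ℂ] (F D j * E D i) = 0 := by
      rw [← TensorProduct.tmul_sub, hs.E_F_ne i j hij, TensorProduct.tmul_zero]
    rw [← add_zero (0 : Uq D ⊗[ℂ] Uq D)]
    nth_rewrite 1 [← h1]
    rw [← h2]
    abel
  · intro i j hij
    rw [add_comm (E D i ⊗ₜ[ℂ] K D i), add_comm (E D j ⊗ₜ[ℂ] K D j)]
    refine serre_add_add hij _ _ _ _ ?_ ?_ ?_ ?_ ?_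
    · simp only [Algebra.TensorProduct.tmul_mul_tmul, mul_one, one_mul]
      rw [hs.K_E, TensorProduct.tmul_smul, D.qa_self]
    · simp only [Algebra.TensorProduct.tmul_mul_tmul, mul_one, one_mul]
      rw [hs.K_E, TensorProduct.tmul_smul]
    · simp only [Algebra.TensorProduct.tmul_mul_tmul, mul_one, one_mul]
      rw [hs.K_E, TensorProduct.tmul_smul, D.qa_symm]
    · exact serre_tmul_right _ _ _ _ _ _ rfl (hs.serre_E i j hij)
    · exact serre_tmul_left _ _ _ _ _ _ (hs.K_K i j) (hs.serre_E i j hij)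
  · intro i j hij
    refine serre_add_add hij _ _ _ _ ?_ ?_ ?_ ?_ ?_
    · simp only [Algebra.TensorProduct.tmul_mul_tmul, mul_one, one_mul]
      rw [← hs.Kinv_F, TensorProduct.smul_tmul', D.qa_self]
    · simp only [Algebra.TensorProduct.tmul_mul_tmul, mul_one, one_mul]
      rw [← hs.Kinv_F, TensorProduct.smul_tmul']
    · simp only [Algebra.TensorProduct.tmul_mul_tmul, mul_one, one_mul]
      rw [← hs.Kinv_F, TensorProduct.smul_tmul', D.qa_symm]
    · exact serre_tmul_left _ _ _ _ _ _ rfl (hs.serre_F i j hij)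
    · exact serre_tmul_right _ _ _ _ _ _ (hs.Kinv_Kinv i j) (hs.serre_F i j hij)

/-- The coproduct `Δ(K_i) = K_i ⊗ K_i`, `Δ(E_i) = E_i ⊗ K_i + 1 ⊗ E_i`,
`Δ(F_i) = F_i ⊗ 1 + K_i⁻¹ ⊗ F_i`. -/
def comulHom (D : Datum I) : Uq D →ₐ[ℂ] Uq D ⊗[ℂ] Uq D := lift (satisfies_comul D)

theorem serre_mul_Kinv {i j : I} (hij : i ≠ j) :
    serre (D.qi i) (D.serreExp i j) (E D i * Kinv D i) (E D j * Kinv D j) = 0 := by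
  have hs := satisfies D
  rw [hs.Kinv_E i i, hs.Kinv_E j j, ← smul_mul_assoc, ← smul_mul_assoc]
  refine serre_twist (D.qi_pos i) _ _ _ _ _ (D.qa i i) (D.qa i j) ?_ ?_ ?_ ?_
    (hs.serre_E i j hij)
  · simp only [smul_mul_assoc, mul_smul_comm]
    rw [hs.Kinv_Kinv i j, smul_comm]
  · rw [mul_smul_comm, hs.Kinv_E i i, smul_mul_assoc]
  · rw [mul_smul_comm, hs.Kinv_E j i, smul_mul_assoc, smul_comm, D.qa_symm j i]
  · rw [mul_smul_comm, hs.Kinv_E i j, smul_mul_assoc, smul_comm]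

theorem serre_K_mul {i j : I} (hij : i ≠ j) :
    serre (D.qi i) (D.serreExp i j) (K D i * F D i) (K D j * F D j) = 0 := by
  have hs := satisfies D
  refine serre_twist (D.qi_pos i) _ _ _ _ _ (D.qa i i) (D.qa i j) (hs.K_K i j) ?_ ?_ ?_
    (hs.serre_F i j hij)
  · rw [hs.K_F]
  · rw [D.qa_symm, hs.K_F]
  · rw [hs.K_F]

theorem serre_neg_neg {A : Type*} [Ring A] [Algebra ℂ A] {t : ℝ} (ht : 0 < t) (n : ℕ) (x y : A)
    (h : serre t n x y = 0) : serre t n (-x) (-y) = 0 := by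
  have := serre_twist ht n x y (-1) (-1) 1 1 rfl (by simp) (by simp) (by simp) h
  simpa using this

theorem E_Kinv_K_F (i j : I) :
    E D i * Kinv D i * (K D j * F D j) = K D j * (E D i * F D j) * Kinv D i := by
  have hs := satisfies D
  calc E D i * Kinv D i * (K D j * F D j)
      = E D i * (Kinv D i * K D j) * F D j := by simp only [mul_assoc]
    _ = E D i * K D j * (Kinv D i * F D j) := by rw [← hs.K_Kinv_comm j i]; simp only [mul_assoc]
    _ = (D.qa j i • (E D i * K D j)) * (F D j * Kinv D i) := by
        rw [← hs.Kinv_F i j, D.qa_symm, mul_smul_comm, smul_mul_assoc]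
    _ = K D j * (E D i * F D j) * Kinv D i := by rw [← hs.K_E]; simp only [mul_assoc]

theorem commutator_twist (i j : I) :
    E D i * Kinv D i * (K D j * F D j) - K D j * F D j * (E D i * Kinv D i) =
      K D j * (E D i * F D j - F D j * E D i) * Kinv D i := by
  rw [E_Kinv_K_F]
  simp only [mul_sub, sub_mul, mul_assoc]

theorem commutator_twist_self (i : I) :
    E D i * Kinv D i * (K D i * F D i) - K D i * F D i * (E D i * Kinv D i) =
      ((D.qi i - (D.qi i)⁻¹ : ℝ) : ℂ)⁻¹ • (K D i - Kinv D i) := by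
  have hs := satisfies D
  rw [commutator_twist, hs.E_F_self, mul_smul_comm, smul_mul_assoc, mul_sub, sub_mul,
    mul_Kinv_cancel, K_Kinv, one_mul]

theorem commutator_twist_ne (i j : I) (hij : i ≠ j) :
    E D i * Kinv D i * (K D j * F D j) - K D j * F D j * (E D i * Kinv D i) = 0 := by
  have hs := satisfies D
  rw [commutator_twist, hs.E_F_ne i j hij, mul_zero, zero_mul]

theorem E_Kinv_Kinv (i j : I) :
    E D j * Kinv D j * Kinv D i = D.qa i j • (Kinv D i * (E D j * Kinv D j)) := by
  have hs := satisfies D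
  rw [mul_assoc, hs.Kinv_Kinv j i, ← mul_assoc, hs.Kinv_E, smul_mul_assoc, mul_assoc]

theorem K_E_Kinv (i j : I) :
    K D i * (E D j * Kinv D j) = D.qa i j • (E D j * Kinv D j * K D i) := by
  have hs := satisfies D
  rw [← mul_assoc, hs.K_E, smul_mul_assoc, mul_assoc, hs.K_Kinv_comm, mul_assoc]

theorem K_F_K (i j : I) : K D j * F D j * K D i = D.qa i j • (K D i * (K D j * F D j)) := by
  have hs := satisfies D
  rw [mul_assoc, ← hs.K_F, mul_smul_comm, ← mul_assoc, hs.K_K j i, mul_assoc]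

theorem Kinv_K_F (i j : I) :
    Kinv D i * (K D j * F D j) = D.qa i j • (K D j * F D j * Kinv D i) := by
  have hs := satisfies D
  rw [← mul_assoc, ← hs.K_Kinv_comm, mul_assoc, ← hs.Kinv_F, mul_smul_comm, mul_assoc]

open MulOpposite in
theorem satisfies_antipode (D : Datum I) :
    D.Satisfies (A := (Uq D)ᵐᵒᵖ) (fun i => op (-(E D i * Kinv D i)))
      (fun i => op (-(K D i * F D i))) (fun i => op (Kinv D i)) (fun i => op (K D i)) := by
  have hs := satisfies D
  have hserre : ∀ (t : ℝ) (n : ℕ) (x y : Uq D),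
      serre t n (op x) (op y) = ((-1 : ℂ) ^ n) • op (serre t n x y) := fun t n x y =>
    serre_anti (opAddEquiv (α := Uq D)).toAddMonoidHom (fun _ _ => rfl) rfl (fun _ _ => rfl)
      t n x y
  refine ⟨?_, ?_, ?_, ?_, ?_, ?_, ?_, ?_, ?_⟩
  · intro i
    rw [← op_mul, K_Kinv, op_one]
  · intro i
    rw [← op_mul, Kinv_K, op_one]
  · intro i j
    rw [← op_mul, ← op_mul, hs.Kinv_Kinv]
  · intro i j
    rw [← op_mul, ← op_mul, ← op_smul, neg_mul, E_Kinv_Kinv, mul_neg, smul_neg]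
  · intro i j
    rw [← op_mul, ← op_mul, ← op_smul, mul_neg, Kinv_K_F, neg_mul, smul_neg]
  · intro i
    rw [← op_mul, ← op_mul, ← op_sub, ← op_sub, ← op_smul, neg_mul_neg, neg_mul_neg,
      ← neg_sub, commutator_twist_self, ← smul_neg, neg_sub]
  · intro i j hij
    rw [← op_mul, ← op_mul, ← op_sub, neg_mul_neg, neg_mul_neg, ← neg_sub,
      commutator_twist_ne i j hij, neg_zero, op_zero]
  · intro i j hij
    rw [hserre, serre_neg_neg (D.qi_pos i) _ _ _ (serre_mul_Kinv hij), op_zero, smul_zero]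
  · intro i j hij
    rw [hserre, serre_neg_neg (D.qi_pos i) _ _ _ (serre_K_mul hij), op_zero, smul_zero]

/-- The antipode `S(K_i) = K_i⁻¹`, `S(E_i) = -E_i K_i⁻¹`, `S(F_i) = -K_i F_i`, as an algebra
homomorphism to the opposite algebra. -/
def antipodeHom (D : Datum I) : Uq D →ₐ[ℂ] (Uq D)ᵐᵒᵖ := lift (satisfies_antipode D)

instance : Bialgebra ℂ (Uq D) :=
  Bialgebra.ofAlgHom (comulHom D) (counitHom D)
    (by
      refine algHom_ext ?_ ?_ ?_ ?_ <;> intro i <;>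
        simp [comulHom, TensorProduct.add_tmul, TensorProduct.tmul_add, add_assoc,
          Algebra.TensorProduct.one_def])
    (by
      refine algHom_ext ?_ ?_ ?_ ?_ <;> intro i <;>
        simp [comulHom, counitHom])
    (by
      refine algHom_ext ?_ ?_ ?_ ?_ <;> intro i <;>
        simp [comulHom, counitHom])

theorem comul_apply (x : Uq D) : Coalgebra.comul (R := ℂ) x = comulHom D x := rfl

theorem counit_apply (x : Uq D) : Coalgebra.counit (R := ℂ) x = counitHom D x := rfl

/-- The antipode as a linear map. -/
def antipodeLin (D : Datum I) : Uq D →ₗ[ℂ] Uq D :=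
  (MulOpposite.opLinearEquiv ℂ).symm.toLinearMap ∘ₗ (antipodeHom D).toLinearMap

theorem antipodeLin_mul (x y : Uq D) :
    antipodeLin D (x * y) = antipodeLin D y * antipodeLin D x := by
  simp [antipodeLin]

theorem antipodeLin_algebraMap (r : ℂ) :
    antipodeLin D (algebraMap ℂ (Uq D) r) = algebraMap ℂ (Uq D) r := by
  simp [antipodeLin]

@[simp] theorem antipodeLin_one : antipodeLin D 1 = 1 := by
  simpa using antipodeLin_algebraMap (D := D) 1

@[simp] theorem antipodeLin_E (i : I) : antipodeLin D (E D i) = -(E D i * Kinv D i) := by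
  simp [antipodeLin, antipodeHom]

@[simp] theorem antipodeLin_F (i : I) : antipodeLin D (F D i) = -(K D i * F D i) := by
  simp [antipodeLin, antipodeHom]

@[simp] theorem antipodeLin_K (i : I) : antipodeLin D (K D i) = Kinv D i := by
  simp [antipodeLin, antipodeHom]

@[simp] theorem antipodeLin_Kinv (i : I) : antipodeLin D (Kinv D i) = K D i := by
  simp [antipodeLin, antipodeHom]

theorem mul_antipode_left (x : Uq D) :
    LinearMap.mul' ℂ (Uq D) ((antipodeLin D).rTensor (Uq D) (comulHom D x)) =
      algebraMap ℂ (Uq D) (counitHom D x) := by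
  induction x using Uq.induction with
  | scalar r =>
    rw [AlgHom.commutes, AlgHom.commutes, Algebra.TensorProduct.algebraMap_apply]
    simp [antipodeLin_algebraMap]
  | hE i => simp [comulHom, counitHom, mul_assoc, Kinv_K]
  | hF i => simp [comulHom, counitHom]
  | hK i => simp [comulHom, counitHom, Kinv_K]
  | hKinv i => simp [comulHom, counitHom, K_Kinv]
  | add x y hx hy => simp only [map_add, hx, hy]
  | mul x y hx hy =>
    have key : ∀ z w : Uq D ⊗[ℂ] Uq D,
        LinearMap.mul' ℂ (Uq D) ((antipodeLin D).rTensor (Uq D) (z * w)) =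
        LinearMap.mul' ℂ (Uq D) ((antipodeLin D).rTensor (Uq D)
          ((1 ⊗ₜ LinearMap.mul' ℂ (Uq D) ((antipodeLin D).rTensor (Uq D) z)) * w)) := by
      intro z w
      induction z using TensorProduct.induction_on with
      | zero => simp
      | add z z' hz hz' =>
        simp only [add_mul, map_add, TensorProduct.tmul_add, hz, hz']
      | tmul a b =>
        induction w using TensorProduct.induction_on with
        | zero => simp
        | add w w' hw hw' => simp only [mul_add, map_add, hw, hw']
        | tmul c d => simp [antipodeLin_mul, mul_assoc]
    rw [map_mul, key, hx]
    have e : (1 : Uq D) ⊗ₜ[ℂ] algebraMap ℂ (Uq D) (counitHom D x) =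
        algebraMap ℂ (Uq D ⊗[ℂ] Uq D) (counitHom D x) := by
      rw [Algebra.TensorProduct.algebraMap_apply']
    rw [e, ← Algebra.smul_def, map_smul, map_smul, hy, map_mul, map_mul, Algebra.smul_def]

theorem mul_antipode_right (x : Uq D) :
    LinearMap.mul' ℂ (Uq D) ((antipodeLin D).lTensor (Uq D) (comulHom D x)) =
      algebraMap ℂ (Uq D) (counitHom D x) := by
  induction x using Uq.induction with
  | scalar r =>
    rw [AlgHom.commutes, AlgHom.commutes, Algebra.TensorProduct.algebraMap_apply]
    simp
  | hE i => simp [comulHom, counitHom]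
  | hF i => simp [comulHom, counitHom, ← mul_assoc, Kinv_K]
  | hK i => simp [comulHom, counitHom, K_Kinv]
  | hKinv i => simp [comulHom, counitHom, Kinv_K]
  | add x y hx hy => simp only [map_add, hx, hy]
  | mul x y hx hy =>
    have key : ∀ z w : Uq D ⊗[ℂ] Uq D,
        LinearMap.mul' ℂ (Uq D) ((antipodeLin D).lTensor (Uq D) (z * w)) =
        LinearMap.mul' ℂ (Uq D) ((antipodeLin D).lTensor (Uq D)
          (z * (LinearMap.mul' ℂ (Uq D) ((antipodeLin D).lTensor (Uq D) w) ⊗ₜ 1))) := by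
      intro z w
      induction w using TensorProduct.induction_on with
      | zero => simp
      | add w w' hw hw' =>
        simp only [mul_add, map_add, TensorProduct.add_tmul, hw, hw']
      | tmul c d =>
        induction z using TensorProduct.induction_on with
        | zero => simp
        | add z z' hz hz' => simp only [add_mul, map_add, hz, hz']
        | tmul a b => simp [antipodeLin_mul, mul_assoc]
    rw [map_mul, key, hy]
    have e : algebraMap ℂ (Uq D) (counitHom D y) ⊗ₜ[ℂ] (1 : Uq D) =
        algebraMap ℂ (Uq D ⊗[ℂ] Uq D) (counitHom D y) := by
      rw [Algebra.TensorProduct.algebraMap_apply]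
    rw [e, ← Algebra.commutes, ← Algebra.smul_def, map_smul, map_smul, hx, map_mul, map_mul,
      Algebra.smul_def, Algebra.commutes]

instance : HopfAlgebra ℂ (Uq D) where
  antipode := antipodeLin D
  mul_antipode_rTensor_comul := LinearMap.ext mul_antipode_left
  mul_antipode_lTensor_comul := LinearMap.ext mul_antipode_right

/-! ### The compact real form -/

/-- The opposite algebra with conjugated scalar multiplication. -/
def ConjOp (A : Type*) : Type _ := Aᵐᵒᵖ

namespace ConjOp

variable {A : Type*} [Ring A]

instance : Ring (ConjOp A) := inferInstanceAs (Ring Aᵐᵒᵖ)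

instance [Algebra ℂ A] : Algebra ℂ (ConjOp A) where
  smul c x := MulOpposite.op (starRingEnd ℂ c • MulOpposite.unop x)
  algebraMap := (algebraMap ℂ Aᵐᵒᵖ).comp (starRingEnd ℂ)
  commutes' c x := Algebra.commutes (A := Aᵐᵒᵖ) (starRingEnd ℂ c) x
  smul_def' c x := Algebra.smul_def (A := Aᵐᵒᵖ) (starRingEnd ℂ c) x

/-- The identity map to the conjugate opposite algebra. -/
def of : A ≃+ ConjOp A := MulOpposite.opAddEquiv

theorem of_mul (x y : A) : of (x * y) = of y * of x := rfl

theorem of_one : of (1 : A) = 1 := rfl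

theorem of_smul [Algebra ℂ A] (c : ℂ) (x : A) : of (c • x) = starRingEnd ℂ c • of x := by
  change MulOpposite.op (c • x) = MulOpposite.op (starRingEnd ℂ (starRingEnd ℂ c) • x)
  rw [Complex.conj_conj]

theorem of_smul_real [Algebra ℂ A] (r : ℝ) (x : A) : of ((r : ℂ) • x) = (r : ℂ) • of x := by
  rw [of_smul, Complex.conj_ofReal]

end ConjOp

open ConjOp in
theorem satisfies_star (D : Datum I) :
    D.Satisfies (A := ConjOp (Uq D)) (fun i => of (K D i * F D i))
      (fun i => of (E D i * Kinv D i)) (fun i => of (K D i)) (fun i => of (Kinv D i)) := by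
  have hs := satisfies D
  have hserre : ∀ (t : ℝ) (n : ℕ) (x y : Uq D),
      serre t n (of x) (of y) = ((-1 : ℂ) ^ n) • of (serre t n x y) := fun t n x y =>
    serre_anti (of (A := Uq D)).toAddMonoidHom of_mul of_one of_smul_real t n x y
  have hqa : ∀ i j (x : Uq D), D.qa i j • of x = of (D.qa i j • x) := by
    intro i j x
    rw [of_smul, D.conj_qa]
  refine ⟨?_, ?_, ?_, ?_, ?_, ?_, ?_, ?_, ?_⟩
  · intro i
    rw [← of_mul, Kinv_K, of_one]
  · intro i
    rw [← of_mul, K_Kinv, of_one]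
  · intro i j
    rw [← of_mul, ← of_mul, hs.K_K]
  · intro i j
    rw [← of_mul, ← of_mul, hqa, K_F_K]
  · intro i j
    rw [← of_mul, ← of_mul, hqa, K_E_Kinv]
  · intro i
    rw [← of_mul, ← of_mul, ← map_sub, ← map_sub, commutator_twist_self, of_smul]
    congr 1
    rw [map_inv₀, Complex.conj_ofReal]
  · intro i j hij
    rw [← of_mul, ← of_mul, ← map_sub, commutator_twist_ne j i hij.symm, map_zero]
  · intro i j hij
    rw [hserre, serre_K_mul hij, map_zero, smul_zero]
  · intro i j hij
    rw [hserre, serre_mul_Kinv hij, map_zero, smul_zero]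

/-- The compact real form, as a homomorphism to the conjugate opposite algebra. -/
def starHom (D : Datum I) : Uq D →ₐ[ℂ] ConjOp (Uq D) := lift (satisfies_star D)

/-- The compact real form `K_i^* = K_i`, `E_i^* = K_i F_i`, `F_i^* = E_i K_i⁻¹`, extended to a
conjugate-linear antimultiplicative map. -/
instance : Star (Uq D) := ⟨fun x => ConjOp.of.symm (starHom D x)⟩

theorem star_def (x : Uq D) : star x = ConjOp.of.symm (starHom D x) := rfl

theorem of_star (x : Uq D) : ConjOp.of (star x) = starHom D x := by
  rw [star_def, AddEquiv.apply_symm_apply]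

theorem star_mul' (x y : Uq D) : star (x * y) = star y * star x := by
  apply ConjOp.of.injective
  rw [of_star, ConjOp.of_mul, of_star, of_star, map_mul]

theorem star_add' (x y : Uq D) : star (x + y) = star x + star y := by
  simp only [star_def, map_add]

theorem star_smul' (c : ℂ) (x : Uq D) : star (c • x) = starRingEnd ℂ c • star x := by
  apply ConjOp.of.injective
  rw [of_star, ConjOp.of_smul, of_star, map_smul, Complex.conj_conj]

theorem star_E (i : I) : star (E D i) = K D i * F D i := by
  apply ConjOp.of.injective
  rw [of_star, starHom, lift_E]

theorem star_F (i : I) : star (F D i) = E D i * Kinv D i := by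
  apply ConjOp.of.injective
  rw [of_star, starHom, lift_F]

theorem star_K (i : I) : star (K D i) = K D i := by
  apply ConjOp.of.injective
  rw [of_star, starHom, lift_K]

theorem star_Kinv (i : I) : star (Kinv D i) = Kinv D i := by
  apply ConjOp.of.injective
  rw [of_star, starHom, lift_Kinv]

theorem star_scalar (r : ℂ) :
    star (algebraMap ℂ (Uq D) r) = algebraMap ℂ (Uq D) (starRingEnd ℂ r) := by
  have h1 : star (1 : Uq D) = 1 := by
    apply ConjOp.of.injective
    rw [of_star, map_one, ConjOp.of_one]
  rw [Algebra.algebraMap_eq_smul_one, Algebra.algebraMap_eq_smul_one, star_smul', h1]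

instance : StarRing (Uq D) where
  star_involutive x := by
    induction x using Uq.induction with
    | scalar r => rw [star_scalar, star_scalar, Complex.conj_conj]
    | hE i => rw [star_E, star_mul', star_F, star_K, mul_K_cancel]
    | hF i => rw [star_F, star_mul', star_E, star_Kinv, ← mul_assoc, Kinv_K, one_mul]
    | hK i => rw [star_K, star_K]
    | hKinv i => rw [star_Kinv, star_Kinv]
    | mul x y hx hy => rw [star_mul', star_mul', hx, hy]
    | add x y hx hy => rw [star_add', star_add', hx, hy]
  star_mul := star_mul'
  star_add := star_add'

instance : StarModule ℂ (Uq D) where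
  star_smul := star_smul'

end Uq

/-! ### The datum of a simple Lie algebra -/

section Lie

open LieAlgebra LieAlgebra.IsKilling Module

variable {𝔤 : Type*} [LieRing 𝔤] [LieAlgebra ℂ 𝔤] [FiniteDimensional ℂ 𝔤] [LieAlgebra.IsSimple ℂ 𝔤]
variable {H : LieSubalgebra ℂ 𝔤} [H.IsCartanSubalgebra]

/-- The bilinear form on `𝔥*` induced by the Killing form through the identification
`𝔥 ≃ 𝔥*` that it provides. -/
def killingDual (H : LieSubalgebra ℂ 𝔤) [H.IsCartanSubalgebra] (α β : Dual ℂ H) : ℂ :=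
  killingForm ℂ 𝔤 ((cartanEquivDual H).symm α : 𝔤) ((cartanEquivDual H).symm β : 𝔤)

theorem killingDual_eq (α β : Dual ℂ H) :
    killingDual H α β = α ((cartanEquivDual H).symm β) := by
  have h1 : cartanEquivDual H ((cartanEquivDual H).symm α) ((cartanEquivDual H).symm β) =
      α ((cartanEquivDual H).symm β) := by
    rw [LinearEquiv.apply_symm_apply]
  rw [← h1]
  rfl

theorem killingDual_comm (α β : Dual ℂ H) : killingDual H α β = killingDual H β α :=
  LieModule.traceForm_comm ℂ 𝔤 𝔤 _ _

theorem killingDual_mul_pairing (α β : H.root) :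
    killingDual H ((rootSystem H).root α) ((rootSystem H).root α) *
        ((rootSystem H).pairingIn ℤ β α : ℂ) =
      2 * killingDual H ((rootSystem H).root α) ((rootSystem H).root β) := by
  have h1 : (((rootSystem H).pairingIn ℤ β α : ℤ) : ℂ) = (rootSystem H).pairing β α := by
    rw [← (rootSystem H).algebraMap_pairingIn ℤ]; simp
  have h2 := root_apply_cartanEquivDual_symm_ne_zero (LieSubalgebra.isNonZero_coe_root α)
  rw [h1, killingDual_comm _ ((rootSystem H).root β), killingDual_eq, killingDual_eq,
    rootSystem_pairing_apply, coroot]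
  simp only [rootSystem_root_apply, map_smul, map_nsmul, smul_eq_mul, nsmul_eq_mul]
  simp only [LieModule.Weight.toLinear_apply]
  field_simp
  push_cast
  ring

theorem killingDual_self_pos (α : H.root) :
    0 < (killingDual H ((rootSystem H).root α) ((rootSystem H).root α)).re := by
  set t : H := (cartanEquivDual H).symm ((rootSystem H).root α) with ht
  set s : ℂ := killingDual H ((rootSystem H).root α) ((rootSystem H).root α) with hs
  have h0 : s ≠ 0 := by
    rw [hs, killingDual_eq]
    exact root_apply_cartanEquivDual_symm_ne_zero (LieSubalgebra.isNonZero_coe_root α)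
  have h1 : ∀ β : LieModule.Weight ℂ H 𝔤, ∃ r : ℝ, β t = (r : ℂ) * s := by
    intro β
    have h2 := apply_coroot_eq_cast (H := H) (K := ℂ) (L := 𝔤) α.1 β
    have h3 : s = α.1 ((cartanEquivDual H).symm α.1.toLinear) := by
      rw [hs, killingDual_eq]
      rfl
    rw [coroot] at h2
    generalize ((LieModule.chainBotCoeff (α.1 : H → ℂ) β : ℤ) -
      (LieModule.chainTopCoeff (α.1 : H → ℂ) β : ℤ)) = m at h2
    have h4 : β (2 • (s⁻¹ • t)) = (m : ℂ) := by
      rw [h3]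
      exact h2
    have h5 : 2 * (s⁻¹ * β t) = (m : ℂ) := by
      rw [← h4, ← LieModule.Weight.toLinear_apply, ← LieModule.Weight.toLinear_apply, map_nsmul,
        map_smul]
      simp
    refine ⟨m / 2, ?_⟩
    push_cast
    rw [← h5]
    field_simp
  choose r hr using h1
  have hsum : s = ((∑ β ∈ H.root, r β ^ 2 : ℝ) : ℂ) * s ^ 2 := by
    have h2 := congrArg (fun B => B t t) (restrict_killingForm_eq_sum (K := ℂ) (L := 𝔤) (H := H))
    change s = _ at h2
    conv_lhs => rw [h2]
    have hr' : ∀ β : LieModule.Weight ℂ H 𝔤, LieModule.Weight.toLinear ℂ H 𝔤 β t = (r β : ℂ) * s := hr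
    simp only [LinearMap.coe_sum, Finset.sum_apply, LinearMap.smulRight_apply, LinearMap.smul_apply,
      smul_eq_mul, hr']
    push_cast
    rw [Finset.sum_mul]
    exact Finset.sum_congr rfl fun β _ => by ring
  set R : ℝ := ∑ β ∈ H.root, r β ^ 2
  have hR : 0 ≤ R := Finset.sum_nonneg fun _ _ => sq_nonneg _
  have h6 : (R : ℂ) * s = 1 := by
    have : s * ((R : ℂ) * s) = s * 1 := by
      rw [mul_one]
      conv_rhs => rw [hsum]
      ring
    exact mul_left_cancel₀ h0 this
  have h7 : R * s.re = 1 := by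
    have := congrArg Complex.re h6
    simpa using this
  by_contra h
  nlinarith [mul_nonneg hR (neg_nonneg.2 (not_lt.1 h))]

variable (b : (rootSystem H).Base)

/-- The simple root with index `i`, as an element of `𝔥*`. -/
def simpleRoot (i : b.support) : Dual ℂ H := (rootSystem H).root i

/-- The invariant form `(α_i, α_j)` on simple roots: the form induced by the Killing form,
normalized so that `(α_i, α_i) = 2` for every short simple root. -/
def rootForm (i j : b.support) : ℝ :=
  2 * (killingDual H (simpleRoot b i) (simpleRoot b j)).re /
    ⨅ k : b.support, (killingDual H (simpleRoot b k) (simpleRoot b k)).re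

/-- The Cartan matrix in the convention `(α_i, α_j) = d_i a_ij` with `d_i = (α_i, α_i) / 2`, that
is `a_ij = ⟨α_j, α_i^∨⟩`. -/
def cartan (i j : b.support) : ℤ := b.cartanMatrix j i

theorem rootForm_eq (i j : b.support) : rootForm b i j = rootForm b i i / 2 * cartan b i j := by
  have h := congrArg Complex.re (killingDual_mul_pairing (H := H) i.1 j.1)
  rw [Complex.mul_re] at h
  simp only [Complex.intCast_re, Complex.intCast_im, mul_zero, sub_zero, Complex.mul_re,
    Complex.re_ofNat, Complex.im_ofNat, zero_mul] at h
  unfold rootForm simpleRoot cartan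
  rw [← h]
  change _ = _ * (((rootSystem H).pairingIn ℤ j.1 i.1 : ℤ) : ℝ)
  ring

theorem rootForm_comm (i j : b.support) : rootForm b i j = rootForm b j i := by
  unfold rootForm
  rw [killingDual_comm]

theorem rootForm_self_pos (i : b.support) : 0 < rootForm b i i := by
  unfold rootForm
  refine div_pos (mul_pos two_pos (killingDual_self_pos i.1)) ?_
  have : Nonempty b.support := ⟨i⟩
  obtain ⟨k, hk⟩ := exists_eq_ciInf_of_finite
    (f := fun k : b.support => (killingDual H (simpleRoot b k) (simpleRoot b k)).re)
  rw [← hk]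
  exact killingDual_self_pos k.1

/-- The datum of the quantized enveloping algebra `U_q(𝔤)`, for a simple Lie algebra `𝔤` with
Cartan subalgebra `𝔥`, base `b` of its root system, and real `q > 0`, `q ≠ 1`. -/
def lieDatum (q : ℝ) (hq0 : 0 < q) (hq1 : q ≠ 1) : Datum b.support where
  a := cartan b
  d i := rootForm b i i / 2
  q := q
  q_pos := hq0
  q_ne_one := hq1
  a_self i := b.cartanMatrix_apply_same i
  a_nonpos i j hij := b.cartanMatrix_le_zero_of_ne j i hij.symm
  d_pos i := half_pos (rootForm_self_pos b i)
  symm i j := by rw [← rootForm_eq, ← rootForm_eq, rootForm_comm]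

end Lie

/-! ### Representations -/

section Rep

open Module

variable {D : Datum I} {V : Type*} [AddCommGroup V] [Module ℂ V]

/-- The weight space of weight `μ`, where `μ i` is the integer `2 (μ, α_i) / (α_i, α_i)`: the
vectors on which `K_i` acts by `q^((μ, α_i)) = q_i^(μ i)`. -/
def weightSpace (ρ : Uq D →ₐ[ℂ] End ℂ V) (μ : I → ℤ) : Submodule ℂ V :=
  ⨅ i, LinearMap.ker (ρ (Uq.K D i) - ((D.qi i ^ μ i : ℝ) : ℂ) • LinearMap.id)

/-- Representations (of type 1) that are sums of their weight spaces. -/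
def IsTypeOne (ρ : Uq D →ₐ[ℂ] End ℂ V) : Prop :=
  ⨆ μ : I → ℤ, weightSpace ρ μ = ⊤

/-- `ρ` is the irreducible representation `V(Λ)` of highest weight `Λ`, where `Λ` is the dominant
integral weight with coefficients `Λ i` with respect to the fundamental weights. -/
structure IsHighestWeightIrrep (ρ : Uq D →ₐ[ℂ] End ℂ V) (Λ : I → ℕ) : Prop where
  irreducible : ∀ W : Submodule ℂ V, (∀ X, ∀ v ∈ W, ρ X v ∈ W) → W = ⊥ ∨ W = ⊤
  exists_highest : ∃ v : V, v ≠ 0 ∧ (∀ i, ρ (Uq.E D i) v = 0) ∧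
    v ∈ weightSpace ρ fun i => (Λ i : ℤ)

/-- The dual representation `(X ▷ f)(v) = f(S(X) ▷ v)`. -/
def dualRep (ρ : Uq D →ₐ[ℂ] End ℂ V) : Uq D →ₐ[ℂ] End ℂ (Dual ℂ V) :=
  AlgHom.ofLinearMap
    (Dual.transpose (R := ℂ) ∘ₗ ρ.toLinearMap ∘ₗ HopfAlgebra.antipode ℂ)
    (by
      ext f v
      change f (ρ (Uq.antipodeLin D 1) v) = f v
      rw [Uq.antipodeLin_one, map_one]
      rfl)
    (by
      intro X Y
      ext f v
      change f (ρ (Uq.antipodeLin D (X * Y)) v) = _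
      rw [Uq.antipodeLin_mul, map_mul]
      rfl)

theorem dualRep_apply (ρ : Uq D →ₐ[ℂ] End ℂ V) (X : Uq D) (f : Dual ℂ V) (v : V) :
    dualRep ρ X f v = f (ρ (HopfAlgebra.antipode ℂ X) v) := rfl

/-- The tensor product representation `X ▷ (v ⊗ w) = X₍₁₎ ▷ v ⊗ X₍₂₎ ▷ w`. -/
def tensorRep {W : Type*} [AddCommGroup W] [Module ℂ W] (ρ : Uq D →ₐ[ℂ] End ℂ V)
    (σ : Uq D →ₐ[ℂ] End ℂ W) : Uq D →ₐ[ℂ] End ℂ (V ⊗[ℂ] W) :=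
  (endTensorEndAlgHom (R := ℂ) (A := ℂ) (M := V) (N := W)).comp
    ((Algebra.TensorProduct.map ρ σ).comp (Bialgebra.comulAlgHom ℂ (Uq D)))

/-- The vector `w` is invariant under the subalgebra `𝒰`: `X ▷ w = ε(X) w` for `X ∈ 𝒰`. -/
def IsInvariantVector (ρ : Uq D →ₐ[ℂ] End ℂ V) (𝒰 : Subalgebra ℂ (Uq D)) (w : V) : Prop :=
  ∀ X ∈ 𝒰, ρ X w = (Coalgebra.counit X : ℂ) • w

/-- The inner product of `V` is compatible with the compact real form. -/
def IsUnitary {V : Type*} [NormedAddCommGroup V] [InnerProductSpace ℂ V]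
    (ρ : Uq D →ₐ[ℂ] End ℂ V) : Prop :=
  ∀ (X : Uq D) (v w : V), inner ℂ (ρ X v) w = inner ℂ v (ρ (star X) w)

/-- The matrix coefficient `c_{f,v}(X) = f(X ▷ v)`. -/
def matCoeff (ρ : Uq D →ₐ[ℂ] End ℂ V) (f : Dual ℂ V) (v : V) : Dual ℂ (Uq D) :=
  f ∘ₗ LinearMap.applyₗ v ∘ₗ ρ.toLinearMap

theorem matCoeff_apply (ρ : Uq D →ₐ[ℂ] End ℂ V) (f : Dual ℂ V) (v : V) (X : Uq D) :
    matCoeff ρ f v X = f (ρ X v) := rfl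

end Rep

/-! ### The quantized coordinate ring and generalized flag manifolds -/

section Coord

open Module

variable {D : Datum I}

/-- The product `(φ ψ)(X) = (φ ⊗ ψ)(Δ(X))` of the dual of `U_q(𝔤)`. -/
def dualMul (φ ψ : Dual ℂ (Uq D)) : Dual ℂ (Uq D) :=
  (WithConv.toConv φ * WithConv.toConv ψ).ofConv

/-- The star operation `φ^*(X) = conj (φ(S(X)^*))`. -/
def dualStar (φ : Dual ℂ (Uq D)) : Dual ℂ (Uq D) where
  toFun X := starRingEnd ℂ (φ (star (HopfAlgebra.antipode ℂ X)))
  map_add' X Y := by simp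
  map_smul' c X := by simp

/-- The left action `(X ▷ φ)(Y) = φ(Y X)`. -/
def leftAct (X : Uq D) (φ : Dual ℂ (Uq D)) : Dual ℂ (Uq D) := φ ∘ₗ LinearMap.mulRight ℂ X

/-- The right action `(φ ◁ X)(Y) = φ(X Y)`. -/
def rightAct (φ : Dual ℂ (Uq D)) (X : Uq D) : Dual ℂ (Uq D) := φ ∘ₗ LinearMap.mulLeft ℂ X

variable (D) in
/-- The quantized coordinate ring `ℂ_q[G]`: the span of the matrix coefficients of the
finite-dimensional representations (of type 1) of `U_q(𝔤)`. -/
def coordRing : Submodule ℂ (Dual ℂ (Uq D)) :=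
  Submodule.span ℂ {φ | ∃ (V : Type) (_ : AddCommGroup V) (_ : Module ℂ V)
    (_ : FiniteDimensional ℂ V) (ρ : Uq D →ₐ[ℂ] End ℂ V) (_ : IsTypeOne ρ) (f : Dual ℂ V) (v : V),
    φ = matCoeff ρ f v}

variable (D) in
/-- The quantized Levi factor `U_q(𝔩_S)`, generated by all `K_λ` (equivalently by all `K_i` and
`K_i⁻¹`) and by the `E_i`, `F_i` with `i ∈ S`. -/
def levi (S : Set I) : Subalgebra ℂ (Uq D) :=
  Algebra.adjoin ℂ (Set.range (Uq.K D) ∪ Set.range (Uq.Kinv D) ∪ Uq.E D '' S ∪ Uq.F D '' S)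

variable (D) in
/-- `ℂ_q[G / L_S]`, the elements of `ℂ_q[G]` with `X ▷ a = ε(X) a` for all `X ∈ U_q(𝔩_S)`. -/
def coordQuotRight (S : Set I) : Set (Dual ℂ (Uq D)) :=
  {a | a ∈ coordRing D ∧ ∀ X ∈ levi D S, leftAct X a = (Coalgebra.counit X : ℂ) • a}

variable (D) in
/-- `ℂ_q[L_S \ G]`, the elements of `ℂ_q[G]` with `a ◁ X = ε(X) a` for all `X ∈ U_q(𝔩_S)`. -/
def coordQuotLeft (S : Set I) : Set (Dual ℂ (Uq D)) :=
  {a | a ∈ coordRing D ∧ ∀ X ∈ levi D S, rightAct a X = (Coalgebra.counit X : ℂ) • a}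

variable {V : Type*} [NormedAddCommGroup V] [InnerProductSpace ℂ V]
  {ι : Type*} [Fintype ι]

/-- The dual basis `f^i` of an orthonormal basis `v_i`. -/
def dualVec (v : OrthonormalBasis ι ℂ V) (i : ι) : Dual ℂ V := v.toBasis.coord i

/-- The matrix coefficients `u^i_j(X) = f^i(X ▷ v_j)`. -/
def coeffU (ρ : Uq D →ₐ[ℂ] End ℂ V) (v : OrthonormalBasis ι ℂ V) (i j : ι) : Dual ℂ (Uq D) :=
  matCoeff ρ (dualVec v i) (v j)

/-- The matrix `M^n_m` with entries `(M^n_m)^i_j = (u^m_i)^* u^n_j`. -/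
def matM (ρ : Uq D →ₐ[ℂ] End ℂ V) (v : OrthonormalBasis ι ℂ V) (n m : ι) :
    Matrix ι ι (Dual ℂ (Uq D)) :=
  Matrix.of fun i j => dualMul (dualStar (coeffU ρ v m i)) (coeffU ρ v n j)

/-- The matrix `N^n_m` with entries `(N^n_m)^i_j = u^i_m (u^j_n)^*`. -/
def matN (ρ : Uq D →ₐ[ℂ] End ℂ V) (v : OrthonormalBasis ι ℂ V) (n m : ι) :
    Matrix ι ι (Dual ℂ (Uq D)) :=
  Matrix.of fun i j => dualMul (coeffU ρ v i m) (dualStar (coeffU ρ v j n))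

/-- The matrix `P = ∑_{m,n} c^m_n M^n_m`, where `c m n` stands for `c^m_n`. -/
def matP (ρ : Uq D →ₐ[ℂ] End ℂ V) (v : OrthonormalBasis ι ℂ V) (c : ι → ι → ℂ) :
    Matrix ι ι (Dual ℂ (Uq D)) :=
  ∑ m, ∑ n, c m n • matM ρ v n m

/-- The matrix `Q = ∑_{m,n} c^m_n N^n_m`, where `c m n` stands for `c^m_n`. -/
def matQ (ρ : Uq D →ₐ[ℂ] End ℂ V) (v : OrthonormalBasis ι ℂ V) (c : ι → ι → ℂ) :
    Matrix ι ι (Dual ℂ (Uq D)) :=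
  ∑ m, ∑ n, c m n • matN ρ v n m

/-- The vector `w = ∑_{m,n} c^m_n v_m ⊗ f^n` of `V ⊗ V*`. -/
def vecW (v : OrthonormalBasis ι ℂ V) (c : ι → ι → ℂ) : V ⊗[ℂ] Dual ℂ V :=
  ∑ m, ∑ n, c m n • (v m ⊗ₜ[ℂ] dualVec v n)

end Coord

end QuantumFlag

end

/-! Let `T` be the endomorphism of `V` that corresponds to `w`, so `T x` is the sum of `c m n *
f^n(x)` times `v_m`. Unitarity turns the involution on matrix coefficients into the antipode:
`u^{m*}_i(X) = f^i(S(X) v_m)`. Expanding the products through the coproduct, the two matrices become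
matrix entries of two adjoint actions on `T`: `P^i_j(X) = f^i(S(X₍₁₎) T X₍₂₎ v_j)` and `Q^i_j(X) =
f^i(X₍₁₎ T S(X₍₂₎) v_j)`.

The first formula is a right action of `U_q(𝔤)` on `End V` and the second a left action
(`leftAd_mul`, `rightAd_mul`). Translating `P` on the right, or `Q` on the left, by `X` therefore
amounts to replacing `T` by its transform under `X`; evaluation at `1` returns `T` itself. So `P` is
invariant under the Levi factor exactly when `T` is fixed, through the counit, by the first action,
and `Q` exactly when `T` is fixed by the second. The second action is the one on `V ⊗ V*`
transported to `End V`, which settles `Q`.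

It remains to compare the fixed vectors of the two actions (`levi_le_leftAdStabilizer_iff`). The
elements acting on `T` through the counit form a subalgebra, so only generators matter, and for both
actions the conditions say that `T` commutes with all `ρ(K_i)` and with `ρ(E_i)`, `ρ(F_i)` for `i ∈
S`. The argument uses that the Levi factor contains every `K_i`: for some generators the condition
reduces to a commutator only after `T` is known to commute with `K_i`.

Finally the entries must lie in `ℂ_q[G]`. They are combinations of products of coefficients of `V`
and `V*`, hence coefficients of tensor products, and being of type 1 passes from the irreducible `V`
to its dual and to tensor products. -/

namespace QuantumFlag

open Module

variable {I : Type*} {D : Datum I}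

/-! ### The two adjoint actions on endomorphisms and their stabilizers -/

section Adjoint

variable {V : Type*} [AddCommGroup V] [Module ℂ V]

/-- The linear map `a ⊗ b ↦ ρ(S(a)) T ρ(b)`. -/
noncomputable def leftSandwich (ρ : Uq D →ₐ[ℂ] End ℂ V) (T : End ℂ V) :
    Uq D ⊗[ℂ] Uq D →ₗ[ℂ] End ℂ V :=
  LinearMap.mul' ℂ (End ℂ V) ∘ₗ TensorProduct.map
    (LinearMap.mulRight ℂ T ∘ₗ ρ.toLinearMap ∘ₗ Uq.antipodeLin D) ρ.toLinearMap

/-- The linear map `a ⊗ b ↦ ρ(a) T ρ(S(b))`. -/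
noncomputable def rightSandwich (ρ : Uq D →ₐ[ℂ] End ℂ V) (T : End ℂ V) :
    Uq D ⊗[ℂ] Uq D →ₗ[ℂ] End ℂ V :=
  LinearMap.mul' ℂ (End ℂ V) ∘ₗ TensorProduct.map
    (LinearMap.mulRight ℂ T ∘ₗ ρ.toLinearMap) (ρ.toLinearMap ∘ₗ Uq.antipodeLin D)

@[simp] theorem leftSandwich_tmul (ρ : Uq D →ₐ[ℂ] End ℂ V) (T : End ℂ V) (a b : Uq D) :
    leftSandwich ρ T (a ⊗ₜ b) = ρ (Uq.antipodeLin D a) * T * ρ b := rfl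

@[simp] theorem rightSandwich_tmul (ρ : Uq D →ₐ[ℂ] End ℂ V) (T : End ℂ V) (a b : Uq D) :
    rightSandwich ρ T (a ⊗ₜ b) = ρ a * T * ρ (Uq.antipodeLin D b) := rfl

theorem leftSandwich_smul (ρ : Uq D →ₐ[ℂ] End ℂ V) (c : ℂ) (T : End ℂ V) (z : Uq D ⊗[ℂ] Uq D) :
    leftSandwich ρ (c • T) z = c • leftSandwich ρ T z := by
  induction z using TensorProduct.induction_on with
  | zero => simp
  | tmul a b => simp
  | add x y hx hy => rw [map_add, map_add, hx, hy, smul_add]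

theorem rightSandwich_smul (ρ : Uq D →ₐ[ℂ] End ℂ V) (c : ℂ) (T : End ℂ V) (z : Uq D ⊗[ℂ] Uq D) :
    rightSandwich ρ (c • T) z = c • rightSandwich ρ T z := by
  induction z using TensorProduct.induction_on with
  | zero => simp
  | tmul a b => simp
  | add x y hx hy => rw [map_add, map_add, hx, hy, smul_add]

theorem leftSandwich_add (ρ : Uq D →ₐ[ℂ] End ℂ V) (T T' : End ℂ V) (z : Uq D ⊗[ℂ] Uq D) :
    leftSandwich ρ (T + T') z = leftSandwich ρ T z + leftSandwich ρ T' z := by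
  induction z using TensorProduct.induction_on with
  | zero => simp
  | tmul a b => simp [mul_add, add_mul]
  | add x y hx hy => rw [map_add, map_add, map_add, hx, hy, add_add_add_comm]

theorem rightSandwich_add (ρ : Uq D →ₐ[ℂ] End ℂ V) (T T' : End ℂ V) (z : Uq D ⊗[ℂ] Uq D) :
    rightSandwich ρ (T + T') z = rightSandwich ρ T z + rightSandwich ρ T' z := by
  induction z using TensorProduct.induction_on with
  | zero => simp
  | tmul a b => simp [mul_add, add_mul]
  | add x y hx hy => rw [map_add, map_add, map_add, hx, hy, add_add_add_comm]

/-- The antipode reverses products, `S(ac) T bd = S(c) (S(a) T b) d`, so the left factor `y` acts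
first. For `rightSandwich` the same reversal occurs on the other side of `T`, and the right factor
acts first. -/
theorem leftSandwich_mul (ρ : Uq D →ₐ[ℂ] End ℂ V) (T : End ℂ V) (y z : Uq D ⊗[ℂ] Uq D) :
    leftSandwich ρ T (y * z) = leftSandwich ρ (leftSandwich ρ T y) z := by
  induction y using TensorProduct.induction_on with
  -- The sandwich of the zero endomorphism vanishes, by homogeneity in `T` at the scalar `0`.
  | zero => simpa using (leftSandwich_smul ρ 0 0 z).symm
  | add y y' hy hy' => rw [add_mul, map_add, hy, hy', map_add, leftSandwich_add]
  | tmul a b =>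
    induction z using TensorProduct.induction_on with
    | zero => simp
    | add z z' hz hz' => rw [mul_add, map_add, hz, hz', map_add]
    | tmul c d => simp [Uq.antipodeLin_mul, mul_assoc]

theorem rightSandwich_mul (ρ : Uq D →ₐ[ℂ] End ℂ V) (T : End ℂ V) (y z : Uq D ⊗[ℂ] Uq D) :
    rightSandwich ρ T (y * z) = rightSandwich ρ (rightSandwich ρ T z) y := by
  induction z using TensorProduct.induction_on with
  | zero => simpa using (rightSandwich_smul ρ 0 0 y).symm
  | add z z' hz hz' => rw [mul_add, map_add, hz, hz', map_add, rightSandwich_add]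
  | tmul c d =>
    induction y using TensorProduct.induction_on with
    | zero => simp
    | add y y' hy hy' => rw [add_mul, map_add, hy, hy', map_add]
    | tmul a b => simp [Uq.antipodeLin_mul, mul_assoc]

/-- The left adjoint action `X ↦ S(X₍₁₎) T X₍₂₎` on endomorphisms. -/
noncomputable def leftAd (ρ : Uq D →ₐ[ℂ] End ℂ V) (T : End ℂ V) : Uq D →ₗ[ℂ] End ℂ V :=
  leftSandwich ρ T ∘ₗ (Uq.comulHom D).toLinearMap

/-- The right adjoint action `X ↦ X₍₁₎ T S(X₍₂₎)` on endomorphisms. -/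
noncomputable def rightAd (ρ : Uq D →ₐ[ℂ] End ℂ V) (T : End ℂ V) : Uq D →ₗ[ℂ] End ℂ V :=
  rightSandwich ρ T ∘ₗ (Uq.comulHom D).toLinearMap

theorem leftAd_apply (ρ : Uq D →ₐ[ℂ] End ℂ V) (T : End ℂ V) (X : Uq D) :
    leftAd ρ T X = leftSandwich ρ T (Uq.comulHom D X) := rfl

theorem rightAd_apply (ρ : Uq D →ₐ[ℂ] End ℂ V) (T : End ℂ V) (X : Uq D) :
    rightAd ρ T X = rightSandwich ρ T (Uq.comulHom D X) := rfl

@[simp] theorem leftAd_one (ρ : Uq D →ₐ[ℂ] End ℂ V) (T : End ℂ V) : leftAd ρ T 1 = T := by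
  simp [leftAd_apply, Algebra.TensorProduct.one_def]

@[simp] theorem rightAd_one (ρ : Uq D →ₐ[ℂ] End ℂ V) (T : End ℂ V) : rightAd ρ T 1 = T := by
  simp [rightAd_apply, Algebra.TensorProduct.one_def]

/-- Multiplicativity of the coproduct carries the rule for sandwiches over to `U_q(𝔤)`. The side in
the names is that of the antipode: `leftAd` is a right action and `rightAd` a left action. -/
theorem leftAd_mul (ρ : Uq D →ₐ[ℂ] End ℂ V) (T : End ℂ V) (X Y : Uq D) :
    leftAd ρ T (X * Y) = leftAd ρ (leftAd ρ T X) Y := by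
  simp only [leftAd_apply, map_mul, leftSandwich_mul]

theorem rightAd_mul (ρ : Uq D →ₐ[ℂ] End ℂ V) (T : End ℂ V) (X Y : Uq D) :
    rightAd ρ T (X * Y) = rightAd ρ (rightAd ρ T Y) X := by
  simp only [rightAd_apply, map_mul, rightSandwich_mul]

theorem leftAd_smul (ρ : Uq D →ₐ[ℂ] End ℂ V) (c : ℂ) (T : End ℂ V) (X : Uq D) :
    leftAd ρ (c • T) X = c • leftAd ρ T X := leftSandwich_smul ρ c T _

theorem rightAd_smul (ρ : Uq D →ₐ[ℂ] End ℂ V) (c : ℂ) (T : End ℂ V) (X : Uq D) :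
    rightAd ρ (c • T) X = c • rightAd ρ T X := rightSandwich_smul ρ c T _

/-- The elements that act on `T` through the counit under the left adjoint action. -/
noncomputable def leftAdStabilizer (ρ : Uq D →ₐ[ℂ] End ℂ V)
    (T : End ℂ V) : Subalgebra ℂ (Uq D) where
  carrier := {X | leftAd ρ T X = Uq.counitHom D X • T}
  mul_mem' {X Y} hX hY := by
    simp only [Set.mem_ofPred_eq] at *
    rw [leftAd_mul, hX, leftAd_smul, hY, smul_smul, map_mul]
  add_mem' {X Y} hX hY := by
    simp only [Set.mem_ofPred_eq] at *
    rw [map_add, hX, hY, map_add, add_smul]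
  algebraMap_mem' r := by
    simp [Algebra.algebraMap_eq_smul_one]

/-- The elements that act on `T` through the counit under the right adjoint action. -/
noncomputable def rightAdStabilizer (ρ : Uq D →ₐ[ℂ] End ℂ V)
    (T : End ℂ V) : Subalgebra ℂ (Uq D) where
  carrier := {X | rightAd ρ T X = Uq.counitHom D X • T}
  mul_mem' {X Y} hX hY := by
    simp only [Set.mem_ofPred_eq] at *
    rw [rightAd_mul, hY, rightAd_smul, hX, smul_smul, map_mul, mul_comm]
  add_mem' {X Y} hX hY := by
    simp only [Set.mem_ofPred_eq] at *
    rw [map_add, hX, hY, map_add, add_smul]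
  algebraMap_mem' r := by
    simp [Algebra.algebraMap_eq_smul_one]

theorem mem_leftAdStabilizer {ρ : Uq D →ₐ[ℂ] End ℂ V} {T : End ℂ V} {X : Uq D} :
    X ∈ leftAdStabilizer ρ T ↔ leftAd ρ T X = Uq.counitHom D X • T := Iff.rfl

theorem mem_rightAdStabilizer {ρ : Uq D →ₐ[ℂ] End ℂ V} {T : End ℂ V} {X : Uq D} :
    X ∈ rightAdStabilizer ρ T ↔ rightAd ρ T X = Uq.counitHom D X • T := Iff.rfl

/-! ### Stabilizer conditions on the generators -/

section Generators

variable (ρ : Uq D →ₐ[ℂ] End ℂ V) (T : End ℂ V) (i : I)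

theorem map_K_mul_map_Kinv : ρ (Uq.K D i) * ρ (Uq.Kinv D i) = 1 := by
  rw [← map_mul, Uq.K_Kinv, map_one]

theorem map_Kinv_mul_map_K : ρ (Uq.Kinv D i) * ρ (Uq.K D i) = 1 := by
  rw [← map_mul, Uq.Kinv_K, map_one]

/-- The image of `K_i` as a unit. -/
noncomputable def unitK : (End ℂ V)ˣ :=
  ⟨ρ (Uq.K D i), ρ (Uq.Kinv D i), map_K_mul_map_Kinv ρ i, map_Kinv_mul_map_K ρ i⟩

theorem K_mem_leftAdStabilizer :
    Uq.K D i ∈ leftAdStabilizer ρ T ↔ Commute (ρ (Uq.K D i)) T := by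
  rw [mem_leftAdStabilizer, leftAd_apply]
  simp only [Uq.comulHom, Uq.counitHom, Uq.lift_K, leftSandwich_tmul, Uq.antipodeLin_K, one_smul]
  rw [mul_assoc]
  exact (unitK ρ i).inv_mul_eq_iff_eq_mul.trans eq_comm

theorem K_mem_rightAdStabilizer :
    Uq.K D i ∈ rightAdStabilizer ρ T ↔ Commute (ρ (Uq.K D i)) T := by
  rw [mem_rightAdStabilizer, rightAd_apply]
  simp only [Uq.comulHom, Uq.counitHom, Uq.lift_K, rightSandwich_tmul, Uq.antipodeLin_K, one_smul]
  exact (unitK ρ i).mul_inv_eq_iff_eq_mul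

theorem Kinv_mem_leftAdStabilizer :
    Uq.Kinv D i ∈ leftAdStabilizer ρ T ↔ Commute (ρ (Uq.K D i)) T := by
  rw [mem_leftAdStabilizer, leftAd_apply]
  simp only [Uq.comulHom, Uq.counitHom, Uq.lift_Kinv, leftSandwich_tmul, Uq.antipodeLin_Kinv,
    one_smul]
  exact (unitK ρ i).mul_inv_eq_iff_eq_mul

theorem Kinv_mem_rightAdStabilizer :
    Uq.Kinv D i ∈ rightAdStabilizer ρ T ↔ Commute (ρ (Uq.K D i)) T := by
  rw [mem_rightAdStabilizer, rightAd_apply]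
  simp only [Uq.comulHom, Uq.counitHom, Uq.lift_Kinv, rightSandwich_tmul, Uq.antipodeLin_Kinv,
    one_smul]
  rw [mul_assoc]
  exact (unitK ρ i).inv_mul_eq_iff_eq_mul.trans eq_comm

variable {T i}

/-- Here `E_i` acts by `T ↦ -E_i K_i⁻¹ T K_i + T E_i`, which is a commutator only once `T` has been
moved past `K_i`. By contrast `F_i` acts by `T ↦ K_i (T F_i - F_i T)`, where the invertible factor
cancels with no condition on `T`. -/
theorem E_mem_leftAdStabilizer (h : Commute (ρ (Uq.K D i)) T) :
    Uq.E D i ∈ leftAdStabilizer ρ T ↔ Commute (ρ (Uq.E D i)) T := by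
  rw [mem_leftAdStabilizer, leftAd_apply]
  simp only [Uq.comulHom, Uq.counitHom, Uq.lift_E, map_add, leftSandwich_tmul, Uq.antipodeLin_E,
    Uq.antipodeLin_one, map_neg, map_mul, map_one, zero_smul, neg_mul, one_mul]
  rw [mul_assoc _ T, ← h.eq, ← mul_assoc, mul_assoc _ (ρ (Uq.Kinv D i)), map_Kinv_mul_map_K,
    mul_one, neg_add_eq_zero]
  rfl

theorem F_mem_leftAdStabilizer :
    Uq.F D i ∈ leftAdStabilizer ρ T ↔ Commute (ρ (Uq.F D i)) T := by
  rw [mem_leftAdStabilizer, leftAd_apply]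
  simp only [Uq.comulHom, Uq.counitHom, Uq.lift_F, map_add, leftSandwich_tmul, Uq.antipodeLin_F,
    Uq.antipodeLin_Kinv, map_neg, map_mul, map_one, zero_smul, neg_mul, mul_one]
  rw [neg_add_eq_zero, mul_assoc, mul_assoc]
  exact (unitK ρ i).mul_right_inj

/-- The roles of `E_i` and `F_i` are exchanged: `E_i` acts by `T ↦ (E_i T - T E_i) K_i⁻¹`, while
`F_i` acts by `T ↦ F_i T - K_i⁻¹ T K_i F_i` and needs `T` to commute with `K_i`. -/
theorem E_mem_rightAdStabilizer :
    Uq.E D i ∈ rightAdStabilizer ρ T ↔ Commute (ρ (Uq.E D i)) T := by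
  rw [mem_rightAdStabilizer, rightAd_apply]
  simp only [Uq.comulHom, Uq.counitHom, Uq.lift_E, map_add, rightSandwich_tmul, Uq.antipodeLin_E,
    Uq.antipodeLin_K, map_neg, map_mul, map_one, zero_smul, mul_neg, one_mul]
  rw [add_neg_eq_zero, ← mul_assoc]
  exact (unitK ρ i)⁻¹.mul_left_inj

theorem F_mem_rightAdStabilizer (h : Commute (ρ (Uq.K D i)) T) :
    Uq.F D i ∈ rightAdStabilizer ρ T ↔ Commute (ρ (Uq.F D i)) T := by
  rw [mem_rightAdStabilizer, rightAd_apply]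
  simp only [Uq.comulHom, Uq.counitHom, Uq.lift_F, map_add, rightSandwich_tmul, Uq.antipodeLin_F,
    Uq.antipodeLin_one, map_neg, map_mul, map_one, zero_smul, mul_neg, mul_one]
  rw [add_neg_eq_zero, ← mul_assoc, mul_assoc _ T, ← h.eq, ← mul_assoc, map_Kinv_mul_map_K, one_mul]
  rfl

end Generators

/-! ### Invariance under the Levi factor -/

theorem levi_le_iff {S : Set I} {A : Subalgebra ℂ (Uq D)} :
    levi D S ≤ A ↔ (∀ i, Uq.K D i ∈ A) ∧ (∀ i, Uq.Kinv D i ∈ A) ∧ (∀ i ∈ S, Uq.E D i ∈ A) ∧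
      ∀ i ∈ S, Uq.F D i ∈ A := by
  rw [levi, Algebra.adjoin_le_iff]
  simp only [Set.union_subset_iff, Set.range_subset_iff, Set.image_subset_iff, and_assoc]
  rfl

/-- Both inclusions say that `T` commutes with the images of the generators of the Levi factor. This
is the bridge between the conditions on `P` and on `Q`. -/
theorem levi_le_leftAdStabilizer_iff (ρ : Uq D →ₐ[ℂ] End ℂ V) (T : End ℂ V) (S : Set I) :
    levi D S ≤ leftAdStabilizer ρ T ↔ levi D S ≤ rightAdStabilizer ρ T := by
  simp only [levi_le_iff, K_mem_leftAdStabilizer, K_mem_rightAdStabilizer,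
    Kinv_mem_leftAdStabilizer, Kinv_mem_rightAdStabilizer]
  -- The `K`-conditions agree on both sides; from here on they are available as `h`, as the criteria
  -- for `E_i` on the left and `F_i` on the right require.
  refine and_congr_right fun h => ?_
  simp only [fun i => E_mem_leftAdStabilizer ρ (h i), F_mem_leftAdStabilizer,
    E_mem_rightAdStabilizer, fun i => F_mem_rightAdStabilizer ρ (h i)]

/-- The second tensor factor of the coproduct acts on a functional by precomposition with its
antipode, so on rank one endomorphisms the action is exactly `T ↦ X₍₁₎ T S(X₍₂₎)`. The flip is there
because `dualTensorHom` expects the functional first. -/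
theorem dualTensorHom_comm_tensorRep (ρ : Uq D →ₐ[ℂ] End ℂ V) (X : Uq D) (w : V ⊗[ℂ] Dual ℂ V) :
    dualTensorHom ℂ V V (TensorProduct.comm ℂ V _ (tensorRep ρ (dualRep ρ) X w)) =
      rightAd ρ (dualTensorHom ℂ V V (TensorProduct.comm ℂ V _ w)) X := by
  -- The coproduct of `X` is replaced by an arbitrary tensor `z`; both sides are linear in `z`, so
  -- pure tensors suffice. The later `key` claims use the same device.
  have key : ∀ z : Uq D ⊗[ℂ] Uq D, ∀ w : V ⊗[ℂ] Dual ℂ V,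
      dualTensorHom ℂ V V (TensorProduct.comm ℂ V _
        ((endTensorEndAlgHom.comp (Algebra.TensorProduct.map ρ (dualRep ρ)) :
          Uq D ⊗[ℂ] Uq D →ₐ[ℂ] End ℂ (V ⊗[ℂ] Dual ℂ V)) z w)) =
      rightSandwich ρ (dualTensorHom ℂ V V (TensorProduct.comm ℂ V _ w)) z := by
    intro z w
    induction z using TensorProduct.induction_on with
    | zero => simp
    | add z z' hz hz' => simp only [map_add, LinearMap.add_apply, hz, hz']
    | tmul a b =>
      induction w using TensorProduct.induction_on with
      | zero => simp
      | add w w' hw hw' => simp only [map_add, hw, hw', rightSandwich_add]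
      | tmul v f =>
        -- Both sides send `x` to `f(ρ(S(b)) x) • ρ(a) v`.
        ext x
        simp
        rfl
  exact key _ w

theorem isInvariantVector_tensorRep_dualRep_iff [FiniteDimensional ℂ V]
    (ρ : Uq D →ₐ[ℂ] End ℂ V) (𝒰 : Subalgebra ℂ (Uq D)) (w : V ⊗[ℂ] Dual ℂ V) :
    IsInvariantVector (tensorRep ρ (dualRep ρ)) 𝒰 w ↔
      𝒰 ≤ rightAdStabilizer ρ (dualTensorHom ℂ V V (TensorProduct.comm ℂ V _ w)) := by
  -- Finite dimension makes `V ⊗ V* → End V` an isomorphism, so no invariance is lost in passing to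
  -- endomorphisms.
  have hinj : Function.Injective fun x : V ⊗[ℂ] Dual ℂ V =>
      dualTensorHom ℂ V V (TensorProduct.comm ℂ V _ x) :=
    ((dualTensorHomEquiv ℂ V V).injective.comp (TensorProduct.comm ℂ V _).injective)
  refine forall₂_congr fun X _ => ?_
  rw [mem_rightAdStabilizer, ← dualTensorHom_comm_tensorRep, ← hinj.eq_iff, map_smul, map_smul]
  rfl

end Adjoint

/-! ### Weight spaces and representations of type 1 -/

section TypeOne

variable {V W : Type*} [AddCommGroup V] [Module ℂ V] [AddCommGroup W] [Module ℂ W]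

theorem mem_weightSpace {ρ : Uq D →ₐ[ℂ] End ℂ V} {μ : I → ℤ} {x : V} :
    x ∈ weightSpace ρ μ ↔ ∀ i, ρ (Uq.K D i) x = ((D.qi i ^ μ i : ℝ) : ℂ) • x := by
  simp [weightSpace, sub_eq_zero]

theorem Kinv_apply_of_mem_weightSpace {ρ : Uq D →ₐ[ℂ] End ℂ V} {μ : I → ℤ} {x : V}
    (hx : x ∈ weightSpace ρ μ) (i : I) :
    ρ (Uq.Kinv D i) x = ((D.qi i ^ (-μ i) : ℝ) : ℂ) • x := by
  have h0 : ((D.qi i ^ μ i : ℝ) : ℂ) ≠ 0 := by exact_mod_cast (zpow_pos (D.qi_pos i) _).ne'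
  have h1 : ρ (Uq.Kinv D i) (ρ (Uq.K D i) x) = x := by
    rw [← Module.End.mul_apply, map_Kinv_mul_map_K, Module.End.one_apply]
  rw [mem_weightSpace.1 hx, map_smul] at h1
  rw [zpow_neg, Complex.ofReal_inv, eq_inv_smul_iff₀ h0, h1]

theorem E_apply_mem_weightSpace {ρ : Uq D →ₐ[ℂ] End ℂ V} {μ : I → ℤ} {x : V}
    (hx : x ∈ weightSpace ρ μ) (j : I) :
    ρ (Uq.E D j) x ∈ weightSpace ρ fun i => μ i + D.a i j := by
  refine mem_weightSpace.2 fun i => ?_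
  rw [← Module.End.mul_apply, ← map_mul, Uq.K_E, map_smul, map_mul, LinearMap.smul_apply,
    Module.End.mul_apply, mem_weightSpace.1 hx, map_smul, smul_smul, Datum.qa,
    ← Complex.ofReal_mul, ← zpow_add₀ (D.qi_pos i).ne', add_comm]

theorem F_apply_mem_weightSpace {ρ : Uq D →ₐ[ℂ] End ℂ V} {μ : I → ℤ} {x : V}
    (hx : x ∈ weightSpace ρ μ) (j : I) :
    ρ (Uq.F D j) x ∈ weightSpace ρ fun i => μ i - D.a i j := by
  refine mem_weightSpace.2 fun i => ?_
  have h := congrArg (fun X => ρ X x) (Uq.K_F (D := D) i j)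
  simp only [map_smul, map_mul, LinearMap.smul_apply, Module.End.mul_apply,
    mem_weightSpace.1 hx] at h
  rw [← eq_inv_smul_iff₀ (D.qa_ne_zero i j), smul_smul, Datum.qa, ← Complex.ofReal_inv,
    ← Complex.ofReal_mul, ← zpow_neg, ← zpow_add₀ (D.qi_pos i).ne'] at h
  rw [h, neg_add_eq_sub]

theorem map_mem_of_mem_iSup_weightSpace {ρ : Uq D →ₐ[ℂ] End ℂ V} (f : V →ₗ[ℂ] W)
    {P : Submodule ℂ W} (h : ∀ μ, ∀ x ∈ weightSpace ρ μ, f x ∈ P) :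
    ∀ x ∈ ⨆ μ, weightSpace ρ μ, f x ∈ P := fun _ hx =>
  (iSup_le fun μ y hy => h μ y hy : ⨆ μ, weightSpace ρ μ ≤ Submodule.comap f P) hx

/-- Each generator either rescales a weight space or shifts its weight by a column of the Cartan
matrix, so the sum of the weight spaces is a subrepresentation. -/
theorem apply_mem_iSup_weightSpace (ρ : Uq D →ₐ[ℂ] End ℂ V) (X : Uq D) :
    ∀ x ∈ ⨆ μ, weightSpace ρ μ, ρ X x ∈ ⨆ μ, weightSpace ρ μ := by
  induction X using Uq.induction with
  | scalar r =>
    intro x hx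
    rw [AlgHom.commutes, Module.algebraMap_end_apply]
    exact Submodule.smul_mem _ _ hx
  | hE i =>
    exact map_mem_of_mem_iSup_weightSpace _ fun μ x hx =>
      Submodule.mem_iSup_of_mem _ (E_apply_mem_weightSpace hx i)
  | hF i =>
    exact map_mem_of_mem_iSup_weightSpace _ fun μ x hx =>
      Submodule.mem_iSup_of_mem _ (F_apply_mem_weightSpace hx i)
  | hK i =>
    refine map_mem_of_mem_iSup_weightSpace _ fun μ x hx => Submodule.mem_iSup_of_mem μ ?_
    rw [mem_weightSpace.1 hx]
    exact Submodule.smul_mem _ _ hx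
  | hKinv i =>
    refine map_mem_of_mem_iSup_weightSpace _ fun μ x hx => Submodule.mem_iSup_of_mem μ ?_
    rw [Kinv_apply_of_mem_weightSpace hx]
    exact Submodule.smul_mem _ _ hx
  | mul X Y hX hY =>
    intro x hx
    rw [map_mul]
    exact hX _ (hY _ hx)
  | add X Y hX hY =>
    intro x hx
    rw [map_add]
    exact Submodule.add_mem _ (hX _ hx) (hY _ hx)

/-- The sum of the weight spaces is a subrepresentation containing the highest weight vector, hence
nonzero, hence everything by irreducibility. -/
theorem IsHighestWeightIrrep.isTypeOne {ρ : Uq D →ₐ[ℂ] End ℂ V} {Λ : I → ℕ}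
    (h : IsHighestWeightIrrep ρ Λ) : IsTypeOne ρ := by
  refine (h.irreducible _ (apply_mem_iSup_weightSpace ρ)).resolve_left fun hbot => ?_
  obtain ⟨x, hx0, -, hx⟩ := h.exists_highest
  exact hx0 (by simpa [hbot] using Submodule.mem_iSup_of_mem _ hx)

/-- Only additivity of `f` is assumed, so that the criterion covers the conjugate-linear map `V →
V*` given by the inner product. -/
theorem IsTypeOne.of_surjective {ρ : Uq D →ₐ[ℂ] End ℂ V} (hρ : IsTypeOne ρ)
    {σ : Uq D →ₐ[ℂ] End ℂ W} (f : V →+ W) (hf : Function.Surjective f)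
    (h : ∀ μ, ∀ x ∈ weightSpace ρ μ, f x ∈ ⨆ ν, weightSpace σ ν) : IsTypeOne σ := by
  refine eq_top_iff.2 fun y _ => ?_
  obtain ⟨x, rfl⟩ := hf y
  -- Induction over the supremum asks only for weight vectors, zero and sums, so linearity of `f` is
  -- not needed.
  refine Submodule.iSup_induction (weightSpace ρ) (motive := fun x => f x ∈ ⨆ ν, weightSpace σ ν)
    (hρ ▸ Submodule.mem_top : x ∈ ⨆ μ, weightSpace ρ μ) h ?_ fun x y hx hy => ?_
  · simp
  · rw [map_add]
    exact Submodule.add_mem _ hx hy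

theorem tensorRep_K_tmul (ρ : Uq D →ₐ[ℂ] End ℂ V) (σ : Uq D →ₐ[ℂ] End ℂ W) (i : I) (x : V) (y : W) :
    tensorRep ρ σ (Uq.K D i) (x ⊗ₜ y) = ρ (Uq.K D i) x ⊗ₜ σ (Uq.K D i) y := by
  change endTensorEndAlgHom (Algebra.TensorProduct.map ρ σ (Uq.comulHom D (Uq.K D i))) (x ⊗ₜ y) = _
  simp [Uq.comulHom]
  rfl

theorem tmul_mem_weightSpace {ρ : Uq D →ₐ[ℂ] End ℂ V} {σ : Uq D →ₐ[ℂ] End ℂ W} {μ ν : I → ℤ}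
    {x : V} {y : W} (hx : x ∈ weightSpace ρ μ) (hy : y ∈ weightSpace σ ν) :
    x ⊗ₜ y ∈ weightSpace (tensorRep ρ σ) (μ + ν) := by
  refine mem_weightSpace.2 fun i => ?_
  rw [tensorRep_K_tmul, mem_weightSpace.1 hx, mem_weightSpace.1 hy, TensorProduct.smul_tmul_smul,
    ← Complex.ofReal_mul, ← zpow_add₀ (D.qi_pos i).ne', Pi.add_apply]

theorem IsTypeOne.tensorRep {ρ : Uq D →ₐ[ℂ] End ℂ V} {σ : Uq D →ₐ[ℂ] End ℂ W}
    (hρ : IsTypeOne ρ) (hσ : IsTypeOne σ) : IsTypeOne (tensorRep ρ σ) := by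
  refine eq_top_iff.2 fun z _ => ?_
  induction z using TensorProduct.induction_on with
  | zero => exact Submodule.zero_mem _
  | add x y hx hy => exact Submodule.add_mem _ (hx trivial) (hy trivial)
  | tmul x y =>
    exact map_mem_of_mem_iSup_weightSpace ((TensorProduct.mk ℂ V W).flip y)
      (fun μ x hx => map_mem_of_mem_iSup_weightSpace (TensorProduct.mk ℂ V W x)
        (fun ν y hy => Submodule.mem_iSup_of_mem _ (tmul_mem_weightSpace hx hy))
        y (hσ ▸ Submodule.mem_top)) x (hρ ▸ Submodule.mem_top)

/-! ### Matrix coefficients and their products -/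

theorem matCoeff_mem_coordRing [FiniteDimensional ℂ V] {ρ : Uq D →ₐ[ℂ] End ℂ V} (hρ : IsTypeOne ρ)
    (f : Dual ℂ V) (x : V) : matCoeff ρ f x ∈ coordRing D := by
  -- `coordRing` ranges over spaces in `Type`, while `V` may live in any universe; a basis
  -- transports `ρ` to a coordinate space.
  let e : V ≃ₗ[ℂ] (Fin (finrank ℂ V) → ℂ) := (finBasis ℂ V).equivFun
  refine Submodule.subset_span ⟨Fin (finrank ℂ V) → ℂ, inferInstance, inferInstance, inferInstance,
    (e.conjAlgEquiv ℂ).toAlgHom.comp ρ, ?_, f ∘ₗ e.symm.toLinearMap, e x, ?_⟩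
  · refine hρ.of_surjective e.toLinearMap.toAddMonoidHom e.surjective fun μ x hx =>
      Submodule.mem_iSup_of_mem μ (mem_weightSpace.2 fun i => ?_)
    change e (ρ (Uq.K D i) (e.symm (e x))) = _ • e x
    rw [e.symm_apply_apply, mem_weightSpace.1 hx, map_smul]
  · ext X
    change f (ρ X x) = f (e.symm (e (ρ X (e.symm (e x)))))
    rw [e.symm_apply_apply, e.symm_apply_apply]

theorem dualMul_apply (φ ψ : Dual ℂ (Uq D)) (X : Uq D) :
    dualMul φ ψ X = LinearMap.mul' ℂ ℂ (TensorProduct.map φ ψ (Uq.comulHom D X)) := rfl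

/-- The product on the dual and the tensor product of representations are both defined through the
coproduct, so coefficients multiply by tensoring vectors and functionals. -/
theorem dualMul_matCoeff (ρ : Uq D →ₐ[ℂ] End ℂ V) (σ : Uq D →ₐ[ℂ] End ℂ W) (f : Dual ℂ V) (x : V)
    (g : Dual ℂ W) (y : W) :
    dualMul (matCoeff ρ f x) (matCoeff σ g y) =
      matCoeff (tensorRep ρ σ) (LinearMap.mul' ℂ ℂ ∘ₗ TensorProduct.map f g) (x ⊗ₜ y) := by
  have key : ∀ z : Uq D ⊗[ℂ] Uq D,
      LinearMap.mul' ℂ ℂ (TensorProduct.map (matCoeff ρ f x) (matCoeff σ g y) z) =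
      LinearMap.mul' ℂ ℂ (TensorProduct.map f g
        ((endTensorEndAlgHom.comp (Algebra.TensorProduct.map ρ σ) :
          Uq D ⊗[ℂ] Uq D →ₐ[ℂ] End ℂ (V ⊗[ℂ] W)) z (x ⊗ₜ y))) := by
    intro z
    induction z using TensorProduct.induction_on with
    | zero => simp
    | add z z' hz hz' => simp only [map_add, LinearMap.add_apply, hz, hz']
    | tmul a b =>
      simp [matCoeff_apply]
      rfl
  ext X
  exact key _

theorem dualMul_matCoeff_mem_coordRing [FiniteDimensional ℂ V] [FiniteDimensional ℂ W]
    {ρ : Uq D →ₐ[ℂ] End ℂ V} {σ : Uq D →ₐ[ℂ] End ℂ W} (hρ : IsTypeOne ρ) (hσ : IsTypeOne σ)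
    (f : Dual ℂ V) (x : V) (g : Dual ℂ W) (y : W) :
    dualMul (matCoeff ρ f x) (matCoeff σ g y) ∈ coordRing D := by
  rw [dualMul_matCoeff]
  exact matCoeff_mem_coordRing (hρ.tensorRep hσ) _ _

end TypeOne

/-! ### Unitarity, and the entries of `P` and `Q` as adjoint orbits -/

section Unitary

variable {V : Type*} [NormedAddCommGroup V] [InnerProductSpace ℂ V] {ρ : Uq D →ₐ[ℂ] End ℂ V}

/-- Since `S(K_i) = K_i⁻¹` is self-adjoint, it moves across the inner product onto `x`; its
eigenvalue there is real, so conjugation has no effect and the weight is negated. -/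
theorem innerₛₗ_mem_weightSpace_dualRep (hu : IsUnitary ρ) {μ : I → ℤ} {x : V}
    (hx : x ∈ weightSpace ρ μ) : innerₛₗ ℂ x ∈ weightSpace (dualRep ρ) (-μ) := by
  refine mem_weightSpace.2 fun i => ?_
  ext y
  change inner ℂ x (ρ (Uq.antipodeLin D (Uq.K D i)) y) = (_ : ℂ) • inner ℂ x y
  rw [Uq.antipodeLin_K, ← Uq.star_Kinv, ← hu, Kinv_apply_of_mem_weightSpace hx, inner_smul_left,
    Complex.conj_ofReal, Pi.neg_apply, smul_eq_mul]

theorem IsTypeOne.dualRep [FiniteDimensional ℂ V] (hρ : IsTypeOne ρ) (hu : IsUnitary ρ) :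
    IsTypeOne (dualRep ρ) := by
  refine hρ.of_surjective (innerₛₗ ℂ (E := V)).toAddMonoidHom (fun f => ?_) fun μ x hx =>
    Submodule.mem_iSup_of_mem _ (innerₛₗ_mem_weightSpace_dualRep hu hx)
  have : CompleteSpace V := FiniteDimensional.complete ℂ V
  -- Riesz representation gives surjectivity; in finite dimension every functional is continuous.
  refine ⟨(InnerProductSpace.toDual ℂ V).symm (LinearMap.toContinuousLinearMap f), ?_⟩
  ext y
  exact InnerProductSpace.toDual_symm_apply

variable {ι : Type*} [Fintype ι] (v : OrthonormalBasis ι ℂ V)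

theorem dualVec_apply (i : ι) (x : V) : dualVec v i x = inner ℂ (v i) x := by
  change v.toBasis.repr x i = _
  rw [OrthonormalBasis.coe_toBasis_repr_apply, v.repr_apply_apply]

/-- Conjugation swaps the arguments of `⟨v_m, S(X)^* v_i⟩`, and unitarity then gives `⟨v_i, S(X)
v_m⟩`. Thus the involution takes coefficients of `V` to coefficients of `V*`. -/
theorem dualStar_coeffU (hu : IsUnitary ρ) (m i : ι) :
    dualStar (coeffU ρ v m i) = matCoeff (dualRep ρ) (Dual.eval ℂ V (v m)) (dualVec v i) := by
  ext X
  change starRingEnd ℂ (dualVec v m (ρ (star (Uq.antipodeLin D X)) (v i))) =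
    dualVec v i (ρ (Uq.antipodeLin D X) (v m))
  rw [dualVec_apply, dualVec_apply, inner_conj_symm, hu, star_star]

/-- The endomorphism of `V` that corresponds to a vector of `V ⊗ V*`. -/
noncomputable abbrev endOfTensor (w : V ⊗[ℂ] Dual ℂ V) : End ℂ V :=
  dualTensorHom ℂ V V (TensorProduct.comm ℂ V _ w)

theorem endOfTensor_vecW_apply (c : ι → ι → ℂ) (x : V) :
    endOfTensor (vecW v c) x = ∑ m, ∑ n, (c m n * dualVec v n x) • v m := by
  simp [endOfTensor, vecW, mul_smul]

/-- The sum of `c m n * f^i(S(X₍₁₎) v_m) * f^n(X₍₂₎ v_j)` is `f^i(S(X₍₁₎) T X₍₂₎ v_j)`, because `T`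
is the sum of the `c m n` times `v_m f^n`. For `Q` the antipode falls on `X₍₂₎` instead. -/
theorem matP_apply (hu : IsUnitary ρ) (c : ι → ι → ℂ) (i j : ι) (X : Uq D) :
    matP ρ v c i j X = dualVec v i (leftAd ρ (endOfTensor (vecW v c)) X (v j)) := by
  have key : ∀ z : Uq D ⊗[ℂ] Uq D,
      ∑ m, ∑ n, c m n * LinearMap.mul' ℂ ℂ (TensorProduct.map
        (matCoeff (dualRep ρ) (Dual.eval ℂ V (v m)) (dualVec v i)) (coeffU ρ v n j) z) =
      dualVec v i (leftSandwich ρ (endOfTensor (vecW v c)) z (v j)) := by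
    intro z
    induction z using TensorProduct.induction_on with
    | zero => simp
    | add z z' hz hz' =>
      simp only [map_add, LinearMap.add_apply, ← hz, ← hz', mul_add, Finset.sum_add_distrib]
    | tmul a b =>
      rw [leftSandwich_tmul, Module.End.mul_apply, Module.End.mul_apply, endOfTensor_vecW_apply]
      simp only [map_sum, map_smul, smul_eq_mul]
      refine Finset.sum_congr rfl fun m _ => Finset.sum_congr rfl fun n _ => ?_
      rw [mul_assoc, mul_comm (dualVec v n _)]
      rfl
  rw [leftAd_apply, ← key]
  simp [matP, matM, Matrix.sum_apply, dualMul_apply, dualStar_coeffU v hu]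

theorem matQ_apply (hu : IsUnitary ρ) (c : ι → ι → ℂ) (i j : ι) (X : Uq D) :
    matQ ρ v c i j X = dualVec v i (rightAd ρ (endOfTensor (vecW v c)) X (v j)) := by
  have key : ∀ z : Uq D ⊗[ℂ] Uq D,
      ∑ m, ∑ n, c m n * LinearMap.mul' ℂ ℂ (TensorProduct.map (coeffU ρ v i m)
        (matCoeff (dualRep ρ) (Dual.eval ℂ V (v j)) (dualVec v n)) z) =
      dualVec v i (rightSandwich ρ (endOfTensor (vecW v c)) z (v j)) := by
    intro z
    induction z using TensorProduct.induction_on with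
    | zero => simp
    | add z z' hz hz' =>
      simp only [map_add, LinearMap.add_apply, ← hz, ← hz', mul_add, Finset.sum_add_distrib]
    | tmul a b =>
      rw [rightSandwich_tmul, Module.End.mul_apply, Module.End.mul_apply, endOfTensor_vecW_apply]
      simp only [map_sum, map_smul, smul_eq_mul]
      refine Finset.sum_congr rfl fun m _ => Finset.sum_congr rfl fun n _ => ?_
      rw [mul_assoc, mul_comm (dualVec v n _)]
      rfl
  rw [rightAd_apply, ← key]
  simp [matQ, matN, Matrix.sum_apply, dualMul_apply, dualStar_coeffU v hu]

theorem End.ext_dualVec {A B : End ℂ V}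
    (h : ∀ i j, dualVec v i (A (v j)) = dualVec v i (B (v j))) : A = B :=
  v.toBasis.ext fun j => v.toBasis.ext_elem fun i => by simpa [dualVec] using h i j

theorem matP_mem_coordRing (hρ : IsTypeOne ρ) (hu : IsUnitary ρ) (c : ι → ι → ℂ) (i j : ι) :
    matP ρ v c i j ∈ coordRing D := by
  have : FiniteDimensional ℂ V := v.toBasis.finiteDimensional_of_finite
  simp only [matP, matM, Matrix.sum_apply, Matrix.smul_apply, Matrix.of_apply,
    dualStar_coeffU v hu]
  exact Submodule.sum_mem _ fun m _ => Submodule.sum_mem _ fun n _ => Submodule.smul_mem _ _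
    (dualMul_matCoeff_mem_coordRing (hρ.dualRep hu) hρ _ _ _ _)

theorem matQ_mem_coordRing (hρ : IsTypeOne ρ) (hu : IsUnitary ρ) (c : ι → ι → ℂ) (i j : ι) :
    matQ ρ v c i j ∈ coordRing D := by
  have : FiniteDimensional ℂ V := v.toBasis.finiteDimensional_of_finite
  simp only [matQ, matN, Matrix.sum_apply, Matrix.smul_apply, Matrix.of_apply,
    dualStar_coeffU v hu]
  exact Submodule.sum_mem _ fun m _ => Submodule.sum_mem _ fun n _ => Submodule.smul_mem _ _
    (dualMul_matCoeff_mem_coordRing hρ (hρ.dualRep hu) _ _ _ _)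

/-- Membership in `ℂ_q[G]` is automatic, so only invariance counts, and the value of the entries at
`X * Y` is governed by acting on `T` with `X` first. -/
theorem matP_mem_coordQuotLeft_iff (hρ : IsTypeOne ρ) (hu : IsUnitary ρ) (c : ι → ι → ℂ)
    (S : Set I) :
    (∀ i j, matP ρ v c i j ∈ coordQuotLeft D S) ↔
      levi D S ≤ leftAdStabilizer ρ (endOfTensor (vecW v c)) := by
  constructor
  · intro h X hX
    refine End.ext_dualVec v fun i j => ?_
    -- Evaluation at `1` loses nothing: the entries at `X` and at `1` are those of the transformed
    -- `T` and of `T`.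
    have h1 := congrArg (fun φ => φ 1) ((h i j).2 X hX)
    change matP ρ v c i j (X * 1) = Uq.counitHom D X * matP ρ v c i j 1 at h1
    rw [matP_apply v hu, matP_apply v hu, mul_one, leftAd_one] at h1
    rw [h1, LinearMap.smul_apply, map_smul, smul_eq_mul]
  · refine fun h i j => ⟨matP_mem_coordRing v hρ hu c i j, fun X hX => ?_⟩
    ext Y
    change matP ρ v c i j (X * Y) = Uq.counitHom D X * matP ρ v c i j Y
    rw [matP_apply v hu, matP_apply v hu, leftAd_mul, mem_leftAdStabilizer.1 (h hX), leftAd_smul,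
      LinearMap.smul_apply, map_smul, smul_eq_mul]

theorem matQ_mem_coordQuotRight_iff (hρ : IsTypeOne ρ) (hu : IsUnitary ρ) (c : ι → ι → ℂ)
    (S : Set I) :
    (∀ i j, matQ ρ v c i j ∈ coordQuotRight D S) ↔
      levi D S ≤ rightAdStabilizer ρ (endOfTensor (vecW v c)) := by
  constructor
  · intro h X hX
    refine End.ext_dualVec v fun i j => ?_
    have h1 := congrArg (fun φ => φ 1) ((h i j).2 X hX)
    change matQ ρ v c i j (1 * X) = Uq.counitHom D X * matQ ρ v c i j 1 at h1
    rw [matQ_apply v hu, matQ_apply v hu, one_mul, rightAd_one] at h1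
    rw [h1, LinearMap.smul_apply, map_smul, smul_eq_mul]
  · refine fun h i j => ⟨matQ_mem_coordRing v hρ hu c i j, fun X hX => ?_⟩
    ext Y
    change matQ ρ v c i j (Y * X) = Uq.counitHom D X * matQ ρ v c i j Y
    rw [matQ_apply v hu, matQ_apply v hu, rightAd_mul, mem_rightAdStabilizer.1 (h hX),
      rightAd_smul, LinearMap.smul_apply, map_smul, smul_eq_mul]

end Unitary

end QuantumFlag

theorem mainTheorem10
    {𝔤 : Type*} [LieRing 𝔤] [LieAlgebra ℂ 𝔤] [FiniteDimensional ℂ 𝔤] [LieAlgebra.IsSimple ℂ 𝔤]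
    (𝔥 : LieSubalgebra ℂ 𝔤) [𝔥.IsCartanSubalgebra]
    (b : (LieAlgebra.IsKilling.rootSystem 𝔥).Base)
    (q : ℝ) (hq0 : 0 < q) (hq1 : q ≠ 1)
    (Λ : b.support → ℕ)
    {V : Type*} [NormedAddCommGroup V] [InnerProductSpace ℂ V]
    (ρ : QuantumFlag.Uq (QuantumFlag.lieDatum b q hq0 hq1) →ₐ[ℂ] Module.End ℂ V)
    (hρΛ : QuantumFlag.IsHighestWeightIrrep ρ Λ)
    (hρ : QuantumFlag.IsUnitary ρ)
    {ι : Type*} [Fintype ι] (v : OrthonormalBasis ι ℂ V)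
    (c : ι → ι → ℂ)
    (S : Set b.support) :
    (((∀ i j, QuantumFlag.matP ρ v c i j ∈
          QuantumFlag.coordQuotLeft (QuantumFlag.lieDatum b q hq0 hq1) S) ∧
        (∀ i j, QuantumFlag.matQ ρ v c i j ∈
          QuantumFlag.coordQuotRight (QuantumFlag.lieDatum b q hq0 hq1) S)) ↔
      QuantumFlag.IsInvariantVector (QuantumFlag.tensorRep ρ (QuantumFlag.dualRep ρ))
        (QuantumFlag.levi (QuantumFlag.lieDatum b q hq0 hq1) S) (QuantumFlag.vecW v c)) ∧
    ((∀ i j, QuantumFlag.matP ρ v c i j ∈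
        QuantumFlag.coordQuotLeft (QuantumFlag.lieDatum b q hq0 hq1) S) ↔
      QuantumFlag.IsInvariantVector (QuantumFlag.tensorRep ρ (QuantumFlag.dualRep ρ))
        (QuantumFlag.levi (QuantumFlag.lieDatum b q hq0 hq1) S) (QuantumFlag.vecW v c)) ∧
    ((∀ i j, QuantumFlag.matQ ρ v c i j ∈
        QuantumFlag.coordQuotRight (QuantumFlag.lieDatum b q hq0 hq1) S) ↔
      QuantumFlag.IsInvariantVector (QuantumFlag.tensorRep ρ (QuantumFlag.dualRep ρ))
        (QuantumFlag.levi (QuantumFlag.lieDatum b q hq0 hq1) S) (QuantumFlag.vecW v c)) := by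
  have hQ := (QuantumFlag.matQ_mem_coordQuotRight_iff v hρΛ.isTypeOne hρ c S).trans
    -- Finite dimension of `V` comes from the finite orthonormal basis.
    (have : FiniteDimensional ℂ V := v.toBasis.finiteDimensional_of_finite
    QuantumFlag.isInvariantVector_tensorRep_dualRep_iff ρ _ (QuantumFlag.vecW v c)).symm
  -- The condition on `P` is reduced to the one on `Q` by the equality of the two stabilizer
  -- conditions.
  have hP := (QuantumFlag.matP_mem_coordQuotLeft_iff v hρΛ.isTypeOne hρ c S).trans
    ((QuantumFlag.levi_le_leftAdStabilizer_iff ρ _ S).trans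
      ((QuantumFlag.matQ_mem_coordQuotRight_iff v hρΛ.isTypeOne hρ c S).symm.trans hQ))
  exact ⟨by rw [hP, hQ, and_self_iff], hP, hQ⟩
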